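/- Let $p,q\ge 2$, let $\Omega\subset\mathbb{R}^{p+q}=\mathbb{R}^p\times\mathbb{R}^q$ be a domain (non-empty, open, connected), and let $E\subset\Omega$ be closed in $\Omega$ with $\mathcal{H}^{p+q-1}(E)=0$, where $\mathcal{H}^{s}$ denotes $s$-dimensional Hausdorff measure. A function $u:U\to[-\infty,+\infty)$ on an open set $U\subset\mathbb{R}^n$ is called subharmonic if it is upper semicontinuous and its value at the center of each ball whose closure lies in $U$ is at most its mean over that ball with respect to Lebesgue measure (so $u\equiv-\infty$ on components of $U$ is allowed). A function $u:U\to[-\infty,+\infty)$ on an open set $U\subset\mathbb{R}^{p+q}$ is called separately subharmonic if for every $y\in\mathbb{R}^q$ the function $x\mapsto u(x,y)$ is subharmonic on $\{x\in\mathbb{R}^p:(x,y)\in U\}$, and for every $x\in\mathbb{R}^p$ the function $y\mapsto u(x,y)$ is subharmonic on $\{y\in\mathbb{R}^q:(x,y)\in U\}$. Let $w:\Omega\setminus E\to\mathbb{R}$ be separately subharmonic and suppose that (i) $w\in\mathcal{L}^1_{\mathrm{loc}}(\Omega)$; (ii) $w\in\mathcal{C}^2(\Omega\setminus E)$; (iii)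 $\frac{\partial^2 w}{\partial x_j^2}\in\mathcal{L}^1_{\mathrm{loc}}(\Omega)$ for each $1\le j\le p$, and $\frac{\partial^2 w}{\partial y_k^2}\in\mathcal{L}^1_{\mathrm{loc}}(\Omega)$ for each $1\le k\le q$. (Since $E$ has Lebesgue measure zero, (i) and (iii) make sense although $w$ and its derivatives are defined only on $\Omega\setminus E$.) Then $w$ has a separately subharmonic extension to $\Omega$, that is, there is a separately subharmonic function $W:\Omega\to[-\infty,+\infty)$ with $W=w$ on $\Omega\setminus E$. -/

import Mathlib

open Set MeasureTheory

noncomputable section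

namespace SepSubharmonic

/-- Mean value of an extended-real function over the open ball `B(a, r)` of `ℝⁿ` with respect to
Lebesgue measure: (average of `u⁺`) minus (average of `u⁻`), with `c - ∞ = -∞`. -/
def ballMean {n : ℕ} (u : EuclideanSpace ℝ (Fin n) → EReal)
    (a : EuclideanSpace ℝ (Fin n)) (r : ℝ) : EReal :=
  ((⨍⁻ z in Metric.ball a r, (u z).toENNReal ∂volume : ENNReal) : EReal) -
    ((⨍⁻ z in Metric.ball a r, (-(u z)).toENNReal ∂volume : ENNReal) : EReal)

/-- Subharmonic functions `u : U → [-∞, +∞)` on an open set `U ⊆ ℝⁿ`: upper semicontinuous with the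
sub-mean value inequality on every ball whose closure lies in `U`.
The value `-∞` is allowed, also identically on components of `U`. Only `u` on `U` matters. -/
structure SubharmonicOn {n : ℕ} (u : EuclideanSpace ℝ (Fin n) → EReal)
    (U : Set (EuclideanSpace ℝ (Fin n))) : Prop where
  lt_top : ∀ a ∈ U, u a < ⊤
  upperSemicontinuousOn : UpperSemicontinuousOn u U
  le_ballMean : ∀ (a : EuclideanSpace ℝ (Fin n)) (r : ℝ), 0 < r →
    Metric.closedBall a r ⊆ U → u a ≤ ballMean u a r

/-- The point `(x, y) ∈ ℝ^(p+q)` for `x ∈ ℝ^p`, `y ∈ ℝ^q`. -/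
def join {p q : ℕ} (x : EuclideanSpace ℝ (Fin p)) (y : EuclideanSpace ℝ (Fin q)) :
    EuclideanSpace ℝ (Fin (p + q)) :=
  WithLp.toLp 2 (Fin.append (fun i => x i) (fun j => y j))

/-- Separately subharmonic functions on an open set `U ⊆ ℝ^(p+q) = ℝ^p × ℝ^q`: for every `y` the
function `x ↦ w (x, y)` is subharmonic on the slice `U(y)`, and for every `x` the function
`y ↦ w (x, y)` is subharmonic on the slice `U(x)`. -/
def SeparatelySubharmonicOn (p q : ℕ) (w : EuclideanSpace ℝ (Fin (p + q)) → EReal)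
    (U : Set (EuclideanSpace ℝ (Fin (p + q)))) : Prop :=
  (∀ y : EuclideanSpace ℝ (Fin q),
    SubharmonicOn (fun x : EuclideanSpace ℝ (Fin p) => w (join x y)) {x | join x y ∈ U}) ∧
  (∀ x : EuclideanSpace ℝ (Fin p),
    SubharmonicOn (fun y : EuclideanSpace ℝ (Fin q) => w (join x y)) {y | join x y ∈ U})

/-- The partial derivative `∂f/∂z_i`. -/
def partialDeriv {n : ℕ} (i : Fin n) (f : EuclideanSpace ℝ (Fin n) → ℝ)
    (z : EuclideanSpace ℝ (Fin n)) : ℝ :=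
  lineDeriv ℝ f z (EuclideanSpace.single i 1)

end SepSubharmonic

end

/-! Let `W (x, y)` be the infimum over `r` of the averages of `w` over `B(x, r) × B(y, r)`. The
averages over `B(x, r) × B(y, s)` increase with each radius: by Green's identity in `x`, the
difference of two of them is the integral of `Δₓ w ≥ 0` against a nonnegative `C^{1,1}` radial
profile. The identity survives across `E`, since it is proved one coordinate direction at a time by
integrating by parts on lines, and almost every line parallel to a given direction misses an
`H^{n-1}`-null set.

By monotonicity the infimum is a limit as `r → 0`, so `W = w` wherever `w` is continuous, and `W` is
upper semicontinuous as an infimum of continuous functions. Averaging in `x` commutes with the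
averages defining `W`, so the sub-mean value inequality of the slices of `W` follows from
monotonicity in the first radius and monotone convergence.
-/

open Filter Topology Module

namespace SepSubharmonic

theorem integral_eq_zero_of_hasDerivAt_off_countable {F : Type*} [NormedAddCommGroup F]
    [NormedSpace ℝ F] [CompleteSpace F] {f f' : ℝ → F} {S : Set ℝ} (hS : S.Countable)
    (hf : Continuous f) (hsupp : HasCompactSupport f) (hderiv : ∀ t ∉ S, HasDerivAt f (f' t) t)
    (hf' : Integrable f') : ∫ t, f' t = 0 := by
  have hlim : Tendsto (fun b => ∫ t in -b..b, f' t) atTop (𝓝 (∫ t, f' t)) :=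
    intervalIntegral_tendsto_integral hf' tendsto_neg_atTop_atBot tendsto_id
  have hzero : Tendsto (fun b => f b - f (-b)) atTop (𝓝 (0 - 0)) :=
    (hsupp.is_zero_at_infty.mono_left atTop_le_cocompact).sub
      ((hsupp.is_zero_at_infty.mono_left atBot_le_cocompact).comp tendsto_neg_atTop_atBot)
  rw [sub_zero] at hzero
  refine tendsto_nhds_unique (hlim.congr fun b => ?_) hzero
  exact integral_eq_of_hasDerivAt_off_countable f f' hS hf.continuousOn (fun t ht => hderiv t ht.2)
    hf'.intervalIntegrable

theorem integral_mul_sub_mul_eq_zero {w w₁ w₂ φ φ₁ φ₂ : ℝ → ℝ} {S : Set ℝ} (hS : S.Countable)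
    (hw : ∀ t ∈ tsupport φ, HasDerivAt w (w₁ t) t) (hw₁ : ∀ t ∈ tsupport φ, HasDerivAt w₁ (w₂ t) t)
    (hφ : ∀ t, HasDerivAt φ (φ₁ t) t) (hφ₁ : Continuous φ₁)
    (hφ₂ : ∀ t ∉ S, HasDerivAt φ₁ (φ₂ t) t) (hsupp : HasCompactSupport φ)
    (h_int : Integrable fun t => w t * φ₂ t - φ t * w₂ t) :
    ∫ t, (w t * φ₂ t - φ t * w₂ t) = 0 := by
  have hφ₁_eq : φ₁ = deriv φ := funext fun t => (hφ t).deriv.symm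
  have hφ_zero : ∀ t ∉ tsupport φ, φ =ᶠ[𝓝 t] 0 := fun t => notMem_tsupport_iff_eventuallyEq.1
  have hφ₁_zero : ∀ t ∉ tsupport φ, φ₁ =ᶠ[𝓝 t] 0 := fun t ht =>
    notMem_tsupport_iff_eventuallyEq.1 fun h => ht (tsupport_deriv_subset (hφ₁_eq ▸ h))
  set H : ℝ → ℝ := fun t => w t * φ₁ t - φ t * w₁ t with hH
  have hH_zero : ∀ t ∉ tsupport φ, H =ᶠ[𝓝 t] 0 := fun t ht => by
    filter_upwards [hφ_zero t ht, hφ₁_zero t ht] with s h h₁ using by simp [hH, h, h₁]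
  have hH_cont : Continuous H := continuous_iff_continuousAt.2 fun t => by
    by_cases ht : t ∈ tsupport φ
    · exact ((hw t ht).continuousAt.mul hφ₁.continuousAt).sub
        ((hφ t).continuousAt.mul (hw₁ t ht).continuousAt)
    · exact continuousAt_const.congr (hH_zero t ht).symm
  have hH_supp : HasCompactSupport H := hsupp.mono' fun t ht => by
    contrapose! ht
    simpa using (hH_zero t ht).eq_of_nhds
  refine integral_eq_zero_of_hasDerivAt_off_countable hS hH_cont hH_supp (fun t hts => ?_) h_int
  by_cases ht : t ∈ tsupport φ
  · exact (((hw t ht).mul (hφ₂ t hts)).sub ((hφ t).mul (hw₁ t ht))).congr_deriv (by ring)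
  · have hφ₂_zero : φ₂ t = 0 :=
      (hφ₂ t hts).unique ((hasDerivAt_const t (0 : ℝ)).congr_of_eventuallyEq (hφ₁_zero t ht))
    exact ((hasDerivAt_const t (0 : ℝ)).congr_of_eventuallyEq (hH_zero t ht)).congr_deriv
      (by simp [(hφ_zero t ht).eq_of_nhds, hφ₂_zero])

section Lines

variable {V : Type*} [NormedAddCommGroup V] [NormedSpace ℝ V]

theorem hasDerivAt_comp_add_smul {f : V → ℝ} {f' : ℝ} {z v : V} {t : ℝ}
    (h : HasLineDerivAt ℝ f f' (z + t • v) v) : HasDerivAt (fun s : ℝ => f (z + s • v)) f' t := by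
  have hshift : HasDerivAt (fun s : ℝ => f (z + t • v + s • v)) f' (t - t) := by
    simpa [HasLineDerivAt] using h
  refine (hshift.comp_sub_const t t).congr_of_eventuallyEq (.of_forall fun s => ?_)
  simp only [add_assoc, ← add_smul, add_sub_cancel]

theorem isClosedEmbedding_add_smul (z : V) {v : V} (hv : v ≠ 0) :
    IsClosedEmbedding fun t : ℝ => z + t • v :=
  (Homeomorph.addLeft z).isClosedEmbedding.comp (isClosedEmbedding_smul_left hv)

variable [FiniteDimensional ℝ V]

theorem exists_continuousLinearEquiv_prod_apply_eq {v : V} (hv : v ≠ 0) :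
    ∃ L : V ≃L[ℝ] (Fin (finrank ℝ V - 1) → ℝ) × ℝ, L v = (0, 1) := by
  have : Nontrivial V := nontrivial_iff.2 ⟨v, 0, hv⟩
  have hdim : finrank ℝ V = finrank ℝ ((Fin (finrank ℝ V - 1) → ℝ) × ℝ) := by
    simpa using (Nat.sub_add_cancel finrank_pos).symm
  obtain ⟨M, hM⟩ := SeparatingDual.exists_continuousLinearEquiv_apply_eq (R := ℝ)
    (x := ContinuousLinearEquiv.ofFinrankEq hdim v) (y := (0, 1)) (by simpa using hv) (by simp)
  exact ⟨(ContinuousLinearEquiv.ofFinrankEq hdim).trans M, hM⟩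

variable [MeasurableSpace V] [BorelSpace V] (μ : Measure V) [μ.IsAddHaarMeasure]

theorem ae_forall_add_smul_notMem {E : Set V}
    (hE : Measure.hausdorffMeasure ((finrank ℝ V : ℝ) - 1) E = 0) {v : V} (hv : v ≠ 0) :
    ∀ᵐ z ∂μ, ∀ t : ℝ, z + t • v ∉ E := by
  obtain ⟨L, hL⟩ := exists_continuousLinearEquiv_prod_apply_eq hv
  have : Nontrivial V := nontrivial_iff.2 ⟨v, 0, hv⟩
  let P : V →L[ℝ] (Fin (finrank ℝ V - 1) → ℝ) := .comp (.fst ℝ _ ℝ) (L : V →L[ℝ] _)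
  have hP_null : volume (P '' E) = 0 := by
    have hdim : ((finrank ℝ V - 1 : ℕ) : ℝ) = (finrank ℝ V : ℝ) - 1 :=
      Nat.cast_pred finrank_pos
    have hle := P.lipschitz.hausdorffMeasure_image_le (Nat.cast_nonneg (finrank ℝ V - 1)) E
    rw [hdim, hE, mul_zero, ← hdim] at hle
    rw [← hausdorffMeasure_pi_real, Fintype.card_fin]
    exact nonpos_iff_eq_zero.1 hle
  have hL_ae : ∀ᵐ x ∂μ.map L, x.1 ∉ P '' E := by
    rw [Measure.isAddLeftInvariant_eq_smul (μ.map L) (volume.prod volume)]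
    exact Measure.ae_smul_measure
      (Measure.quasiMeasurePreserving_fst.ae (measure_eq_zero_iff_ae_notMem.1 hP_null)) _
  filter_upwards [ae_of_ae_map L.continuous.aemeasurable hL_ae] with z hz t ht
  exact hz ⟨_, ht, by simp [P, hL]⟩

variable {μ}

theorem integral_eq_zero_of_ae_line {v : V} (hv : v ≠ 0) {F : V → ℝ} (hF : Integrable F μ)
    (h : ∀ᵐ z ∂μ, Integrable (fun t : ℝ => F (z + t • v)) → ∫ t : ℝ, F (z + t • v) = 0) :
    ∫ z, F z ∂μ = 0 := by
  obtain ⟨L, hL⟩ := exists_continuousLinearEquiv_prod_apply_eq hv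
  have hline : ∀ y s t, L.symm (y, s) + t • v = L.symm (y, s + t) := fun y s t => by
    rw [← L.symm_apply_apply v, hL, ← map_smul, ← map_add]
    simp
  have hLe : MeasurableEmbedding L := L.toHomeomorph.measurableEmbedding
  set ν : Measure ((Fin (finrank ℝ V - 1) → ℝ) × ℝ) := volume.prod volume
  have hν : ν = Measure.addHaarScalarFactor ν (μ.map L) • μ.map L :=
    Measure.isAddLeftInvariant_eq_smul _ _
  have hFL : Integrable (fun x => F (L.symm x)) ν := by
    rw [hν]
    refine Integrable.smul_measure_nnreal (hLe.integrable_map_iff.2 ?_)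
    simpa [Function.comp_def] using hF
  have hae : ∀ᵐ x ∂ν, Integrable (fun t : ℝ => F (L.symm x + t • v)) →
      ∫ t : ℝ, F (L.symm x + t • v) = 0 := by
    rw [hν]
    refine Measure.ae_smul_measure (hLe.ae_map_iff.2 ?_) _
    simpa using h
  have hν_zero : ∫ x, F (L.symm x) ∂ν = 0 := by
    rw [integral_prod _ hFL]
    refine integral_eq_zero_of_ae ?_
    filter_upwards [hFL.prod_right_ae, Measure.ae_ae_of_ae_prod hae] with y hy hy₀
    obtain ⟨s, hs⟩ := hy₀.exists
    simp only [hline] at hs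
    rw [integral_add_left_eq_self (fun t => F (L.symm (y, t))) s] at hs
    exact hs (hy.comp_add_left s)
  have hμ : μ.map L = Measure.addHaarScalarFactor (μ.map L) ν • ν :=
    Measure.isAddLeftInvariant_eq_smul _ _
  calc ∫ z, F z ∂μ = ∫ x, F (L.symm x) ∂μ.map L := by simp [hLe.integral_map]
    _ = 0 := by rw [hμ, integral_smul_nnreal_measure, hν_zero, smul_zero]

theorem integral_mul_eq_integral_mul_of_hasLineDerivAt {v : V} (hv : v ≠ 0) {E : Set V}
    (hE : Measure.hausdorffMeasure ((finrank ℝ V : ℝ) - 1) E = 0) {w w₁ w₂ φ φ₁ φ₂ : V → ℝ}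
    (hw : ∀ z ∈ tsupport φ \ E, HasLineDerivAt ℝ w (w₁ z) z v)
    (hw₁ : ∀ z ∈ tsupport φ \ E, HasLineDerivAt ℝ w₁ (w₂ z) z v)
    (hφ : ∀ z, HasLineDerivAt ℝ φ (φ₁ z) z v)
    (hφ₁ : ∀ z, Continuous fun t : ℝ => φ₁ (z + t • v))
    (hφ₂ : ∀ z, {t : ℝ | ¬ HasLineDerivAt ℝ φ₁ (φ₂ (z + t • v)) (z + t • v) v}.Countable)
    (hsupp : HasCompactSupport φ) (hwφ₂ : Integrable (fun z => w z * φ₂ z) μ)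
    (hφw₂ : Integrable (fun z => φ z * w₂ z) μ) :
    ∫ z, w z * φ₂ z ∂μ = ∫ z, φ z * w₂ z ∂μ := by
  rw [← sub_eq_zero, ← integral_sub hwφ₂ hφw₂]
  refine integral_eq_zero_of_ae_line hv (hwφ₂.sub hφw₂) ?_
  filter_upwards [ae_forall_add_smul_notMem μ hE hv] with z hz h_int
  have hemb := isClosedEmbedding_add_smul z hv
  have hmem : ∀ t ∈ tsupport fun t : ℝ => φ (z + t • v), z + t • v ∈ tsupport φ \ E :=
    fun t ht => ⟨tsupport_comp_subset_preimage φ hemb.continuous ht, hz t⟩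
  refine integral_mul_sub_mul_eq_zero (hφ₂ z)
    (fun t ht => hasDerivAt_comp_add_smul (hw _ (hmem t ht)))
    (fun t ht => hasDerivAt_comp_add_smul (hw₁ _ (hmem t ht)))
    (fun t => hasDerivAt_comp_add_smul (hφ _)) (hφ₁ z) (fun t ht => ?_)
    (hsupp.comp_isClosedEmbedding hemb) h_int
  exact hasDerivAt_comp_add_smul (not_not.1 ht)

end Lines

section RadialProfile

/-- The derivative of `radialProfile`. -/
noncomputable def radialProfileDeriv (e A B t : ℝ) : ℝ :=
  (max B t ^ (-e) - max A t ^ (-e)) / (4 * e)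

/-- With `e = n / 2`, the function `x ↦ radialProfile e A B (‖x‖ ^ 2)` on `ℝⁿ` is the nonnegative
compactly supported function whose Laplacian is `B ^ (-e)` times the indicator function of the ball
of radius `√B` minus `A ^ (-e)` times that of the ball of radius `√A`. -/
noncomputable def radialProfile (e A B t : ℝ) : ℝ :=
  ∫ s in B..t, radialProfileDeriv e A B s

/-- The second derivative of `radialProfile` away from `A` and `B`. The maximum makes the function
under the indicator continuous on the whole line. -/
noncomputable def radialProfileDeriv₂ (e A B : ℝ) : ℝ → ℝ :=
  (Ico A B).indicator fun t => max A t ^ (-e - 1) / 4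

variable {e A B t : ℝ}

theorem continuous_max_rpow (hA : 0 < A) (s : ℝ) : Continuous fun t : ℝ => max A t ^ s :=
  (continuous_const.max continuous_id).rpow_const fun _ => .inl (lt_max_of_lt_left hA).ne'

theorem continuous_radialProfileDeriv (hA : 0 < A) (hAB : A ≤ B) :
    Continuous (radialProfileDeriv e A B) :=
  ((continuous_max_rpow (hA.trans_le hAB) _).sub (continuous_max_rpow hA _)).div_const _

theorem hasDerivAt_radialProfile (hA : 0 < A) (hAB : A ≤ B) (t : ℝ) :
    HasDerivAt (radialProfile e A B) (radialProfileDeriv e A B t) t :=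
  ((continuous_radialProfileDeriv hA hAB).integral_hasStrictDerivAt B t).hasDerivAt

theorem continuous_radialProfile (hA : 0 < A) (hAB : A ≤ B) : Continuous (radialProfile e A B) :=
  continuous_iff_continuousAt.2 fun t => (hasDerivAt_radialProfile hA hAB t).continuousAt

theorem radialProfileDeriv_eq_zero (hAB : A ≤ B) (ht : B ≤ t) :
    radialProfileDeriv e A B t = 0 := by
  simp [radialProfileDeriv, max_eq_right ht, max_eq_right (hAB.trans ht)]

theorem radialProfileDeriv_nonpos (he : 0 < e) (hA : 0 < A) (hAB : A ≤ B) (t : ℝ) :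
    radialProfileDeriv e A B t ≤ 0 :=
  div_nonpos_of_nonpos_of_nonneg (sub_nonpos.2 <| Real.rpow_le_rpow_of_nonpos
    (lt_max_of_lt_left hA) (max_le_max hAB le_rfl) (neg_nonpos.2 he.le)) (by positivity)

theorem radialProfile_eq_zero (hAB : A ≤ B) (ht : B ≤ t) : radialProfile e A B t = 0 := by
  refine intervalIntegral.integral_zero_ae (ae_of_all _ fun s hs => ?_)
  rw [uIoc_of_le ht] at hs
  exact radialProfileDeriv_eq_zero hAB hs.1.le

theorem radialProfile_nonneg (he : 0 < e) (hA : 0 < A) (hAB : A ≤ B) (t : ℝ) :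
    0 ≤ radialProfile e A B t := by
  rcases le_total B t with ht | ht
  · rw [radialProfile_eq_zero hAB ht]
  · rw [radialProfile, intervalIntegral.integral_symm, ← intervalIntegral.integral_neg]
    exact intervalIntegral.integral_nonneg ht fun s _ =>
      neg_nonneg.2 (radialProfileDeriv_nonpos he hA hAB s)

theorem radialProfileDeriv₂_eq_zero (ht : B ≤ t) : radialProfileDeriv₂ e A B t = 0 :=
  indicator_of_notMem (fun h => h.2.not_ge ht) _

theorem hasDerivAt_radialProfileDeriv (he : 0 < e) (hA : 0 < A) (hAB : A ≤ B)
    (htA : t ≠ A) (htB : t ≠ B) :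
    HasDerivAt (radialProfileDeriv e A B) (radialProfileDeriv₂ e A B t) t := by
  rcases htB.lt_or_gt with hB | hB
  · rcases htA.lt_or_gt with hA' | hA'
    · rw [radialProfileDeriv₂, indicator_of_notMem fun h => h.1.not_gt hA']
      refine (hasDerivAt_const t ((B ^ (-e) - A ^ (-e)) / (4 * e))).congr_of_eventuallyEq ?_
      filter_upwards [Iio_mem_nhds hB, Iio_mem_nhds hA'] with s hsB hsA
      rw [radialProfileDeriv, max_eq_left_of_lt hsB, max_eq_left_of_lt hsA]
    · rw [radialProfileDeriv₂, indicator_of_mem (show t ∈ Ico A B from ⟨hA'.le, hB⟩),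
        max_eq_right_of_lt hA']
      have hderiv : HasDerivAt (fun s : ℝ => (B ^ (-e) - s ^ (-e)) / (4 * e))
          ((0 - (-e) * t ^ (-e - 1)) / (4 * e)) t :=
        ((hasDerivAt_const t _).sub
          (Real.hasDerivAt_rpow_const (.inl (hA.trans hA').ne'))).div_const _
      refine (hderiv.congr_of_eventuallyEq ?_).congr_deriv (by field_simp; ring)
      filter_upwards [Iio_mem_nhds hB, Ioi_mem_nhds hA'] with s hsB hsA
      rw [radialProfileDeriv, max_eq_left_of_lt hsB, max_eq_right_of_lt hsA]
  · rw [radialProfileDeriv₂_eq_zero hB.le]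
    refine (hasDerivAt_const t (0 : ℝ)).congr_of_eventuallyEq ?_
    filter_upwards [Ioi_mem_nhds hB] with s hs using radialProfileDeriv_eq_zero hAB (le_of_lt hs)

theorem radialProfile_laplacian (he : 0 < e) (hA : 0 < A) (hAB : A ≤ B) (t : ℝ) :
    4 * t * radialProfileDeriv₂ e A B t + 4 * e * radialProfileDeriv e A B t =
      (Iio B).indicator (fun _ => B ^ (-e)) t - (Iio A).indicator (fun _ => A ^ (-e)) t := by
  have hderiv : 4 * e * radialProfileDeriv e A B t = max B t ^ (-e) - max A t ^ (-e) := by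
    rw [radialProfileDeriv]; field_simp
  rw [hderiv, radialProfileDeriv₂]
  rcases lt_or_ge t A with htA | htA
  · simp [indicator, htA.not_ge, htA, htA.trans_le hAB, htA.le, (htA.trans_le hAB).le]
  rcases lt_or_ge t B with htB | htB
  · have ht : 0 < t := hA.trans_le htA
    have hpow : t * t ^ (-e - 1) = t ^ (-e) := by
      rw [Real.rpow_sub_one ht.ne', mul_div_cancel₀ _ ht.ne']
    simp only [indicator, mem_Ico, mem_Iio, htA, htA.not_gt, htB, htB.le, and_self, if_true,
      if_false, max_eq_left, max_eq_right]
    linear_combination hpow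
  · simp [indicator, htB.not_gt, htA.not_gt, htA, htB]

end RadialProfile

section Cylinder

variable {V F : Type*} [NormedAddCommGroup V] [NormedSpace ℝ V] [NormedAddCommGroup F]
  [InnerProductSpace ℝ F] {π : V →L[ℝ] F} {a : F} {v : V} {L K : Set V}

theorem finite_setOf_norm_add_smul_sq_eq (x : F) {y : F} (hy : y ≠ 0) (c : ℝ) :
    {t : ℝ | ‖x + t • y‖ ^ 2 = c}.Finite := by
  set P : Polynomial ℝ := .C (‖y‖ ^ 2) * .X ^ 2 + .C (2 * inner ℝ x y) * .X + .C (‖x‖ ^ 2 - c)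
  have hcoeff : P.coeff 2 = ‖y‖ ^ 2 := by
    simp only [P, Polynomial.coeff_add, Polynomial.coeff_C_mul, Polynomial.coeff_X_pow,
      Polynomial.coeff_X, Polynomial.coeff_C]
    norm_num
  have hP : P ≠ 0 := fun h => by
    rw [h, Polynomial.coeff_zero, eq_comm, sq_eq_zero_iff, norm_eq_zero] at hcoeff
    exact hy hcoeff
  refine (Polynomial.finite_setOfPred_isRoot hP).subset fun t ht => ?_
  simp only [mem_ofPred_eq, norm_add_sq_real, inner_smul_right, norm_smul, Real.norm_eq_abs,
    mul_pow, sq_abs] at ht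
  simp only [P, mem_ofPred_eq, Polynomial.IsRoot, Polynomial.eval_add, Polynomial.eval_mul,
    Polynomial.eval_C, Polynomial.eval_pow, Polynomial.eval_X]
  linear_combination ht

theorem hasLineDerivAt_comp_norm_sub_sq {g : ℝ → ℝ} {g' : ℝ} {z : V}
    (hg : HasDerivAt g g' (‖π z - a‖ ^ 2)) (v : V) :
    HasLineDerivAt ℝ (fun z => g (‖π z - a‖ ^ 2)) (g' * (2 * inner ℝ (π z - a) (π v))) z v := by
  have hsq := (π.hasFDerivAt (x := z)).sub_const a |>.norm_sq
  convert! (hg.comp_hasFDerivAt z hsq).hasLineDerivAt v using 1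
  simp [inner_sub_left]

theorem hasLineDerivAt_norm_sub_sq (a x y : F) :
    HasLineDerivAt ℝ (fun x => ‖x - a‖ ^ 2) (2 * inner ℝ (x - a) y) x y := by
  simpa using hasLineDerivAt_comp_norm_sub_sq (π := .id ℝ F) (a := a) (hasDerivAt_id _) y

theorem hasLineDerivAt_inner_sub (a x y : F) :
    HasLineDerivAt ℝ (fun x => inner ℝ (x - a) y) (‖y‖ ^ 2) x y := by
  convert! (((hasFDerivAt_id x).sub_const a).inner ℝ (hasFDerivAt_const y x)).hasLineDerivAt y
    using 1
  simp

theorem hasLineDerivAt_indicator (hL : ∀ z, ∀ t : ℝ, z + t • v ∈ L ↔ z ∈ L) {f f' : V → ℝ} {z : V}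
    (hf : HasLineDerivAt ℝ f (f' z) z v) :
    HasLineDerivAt ℝ (L.indicator f) (L.indicator f' z) z v := by
  unfold HasLineDerivAt at hf ⊢
  by_cases hz : z ∈ L
  · simpa only [indicator, hL, hz, if_true] using hf
  · simpa only [indicator, hL, hz, if_false] using hasDerivAt_const _ _

/-- The test function of Green's identity: `radialProfile` of the squared distance of `π z` to `a`,
on a cylinder `L` over the fibres of `π`. -/
noncomputable def cylinderProfile (π : V →L[ℝ] F) (a : F) (L : Set V) (e A B : ℝ) : V → ℝ :=
  L.indicator fun z => radialProfile e A B (‖π z - a‖ ^ 2)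

/-- The first derivative of `cylinderProfile` in the direction `v`. -/
noncomputable def cylinderProfileDeriv (π : V →L[ℝ] F) (a : F) (L : Set V) (e A B : ℝ) (v : V) :
    V → ℝ :=
  L.indicator fun z => radialProfileDeriv e A B (‖π z - a‖ ^ 2) * (2 * inner ℝ (π z - a) (π v))

/-- The second derivative of `cylinderProfile` in the direction `v`, away from the spheres of radii
`√A` and `√B`. -/
noncomputable def cylinderProfileDeriv₂ (π : V →L[ℝ] F) (a : F) (L : Set V) (e A B : ℝ) (v : V) :
    V → ℝ :=
  L.indicator fun z =>
    radialProfileDeriv₂ e A B (‖π z - a‖ ^ 2) * (2 * inner ℝ (π z - a) (π v)) ^ 2 +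
      radialProfileDeriv e A B (‖π z - a‖ ^ 2) * (2 * ‖π v‖ ^ 2)

variable {e A B : ℝ}

theorem cylinderProfile_nonneg (he : 0 < e) (hA : 0 < A) (hAB : A ≤ B) (z : V) :
    0 ≤ cylinderProfile π a L e A B z :=
  indicator_nonneg (fun _ _ => radialProfile_nonneg he hA hAB _) z

theorem cylinderProfile_eq_zero (hAB : A ≤ B) (hLK : L ∩ {z | ‖π z - a‖ ^ 2 < B} ⊆ K) {z : V}
    (hz : z ∉ K) : cylinderProfile π a L e A B z = 0 :=
  indicator_apply_eq_zero.2 fun hzL =>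
    radialProfile_eq_zero hAB (not_lt.1 fun h => hz (hLK ⟨hzL, h⟩))

theorem cylinderProfileDeriv₂_eq_zero (hAB : A ≤ B) (hLK : L ∩ {z | ‖π z - a‖ ^ 2 < B} ⊆ K)
    {z : V} (hz : z ∉ K) : cylinderProfileDeriv₂ π a L e A B v z = 0 :=
  indicator_apply_eq_zero.2 fun hzL => by
    have hB : B ≤ ‖π z - a‖ ^ 2 := not_lt.1 fun h => hz (hLK ⟨hzL, h⟩)
    simp only [radialProfileDeriv₂_eq_zero hB, radialProfileDeriv_eq_zero hAB hB, zero_mul,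
      add_zero]

theorem hasLineDerivAt_cylinderProfile (hA : 0 < A) (hAB : A ≤ B)
    (hL : ∀ z, ∀ t : ℝ, z + t • v ∈ L ↔ z ∈ L) (z : V) :
    HasLineDerivAt ℝ (cylinderProfile π a L e A B) (cylinderProfileDeriv π a L e A B v z) z v :=
  hasLineDerivAt_indicator hL
    (hasLineDerivAt_comp_norm_sub_sq (hasDerivAt_radialProfile hA hAB _) v)

theorem continuous_cylinderProfileDeriv_line (hA : 0 < A) (hAB : A ≤ B)
    (hL : ∀ z, ∀ t : ℝ, z + t • v ∈ L ↔ z ∈ L) (z : V) :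
    Continuous fun t : ℝ => cylinderProfileDeriv π a L e A B v (z + t • v) := by
  have hderiv := continuous_radialProfileDeriv (e := e) hA hAB
  by_cases hz : z ∈ L
  · simp only [cylinderProfileDeriv, indicator, hL, hz, if_true]
    fun_prop
  · simp only [cylinderProfileDeriv, indicator, hL, hz, if_false]
    fun_prop

theorem hasLineDerivAt_cylinderProfileDeriv (he : 0 < e) (hA : 0 < A) (hAB : A ≤ B)
    (hL : ∀ z, ∀ t : ℝ, z + t • v ∈ L ↔ z ∈ L) {z : V} (hzA : ‖π z - a‖ ^ 2 ≠ A)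
    (hzB : ‖π z - a‖ ^ 2 ≠ B) :
    HasLineDerivAt ℝ (cylinderProfileDeriv π a L e A B v) (cylinderProfileDeriv₂ π a L e A B v z)
      z v := by
  refine hasLineDerivAt_indicator (f' := fun z => radialProfileDeriv₂ e A B (‖π z - a‖ ^ 2) *
    (2 * inner ℝ (π z - a) (π v)) ^ 2 + radialProfileDeriv e A B (‖π z - a‖ ^ 2) *
      (2 * ‖π v‖ ^ 2)) hL ?_
  have hprofile := hasLineDerivAt_comp_norm_sub_sq (v := v)
    (hasDerivAt_radialProfileDeriv he hA hAB hzA hzB)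
  have hinner : HasLineDerivAt ℝ (fun z => 2 * inner ℝ (π z - a) (π v)) (2 * ‖π v‖ ^ 2) z v := by
    have hfderiv := (((π.hasFDerivAt (x := z)).sub_const a).inner ℝ
      (hasFDerivAt_const (π v) z)).const_mul 2
    convert! hfderiv.hasLineDerivAt v using 1
    simp
  refine (HasDerivAt.mul hprofile hinner).congr_deriv ?_
  simp only [zero_smul, add_zero]
  ring

theorem countable_not_hasLineDerivAt_cylinderProfileDeriv (he : 0 < e) (hA : 0 < A) (hAB : A ≤ B)
    (hL : ∀ z, ∀ t : ℝ, z + t • v ∈ L ↔ z ∈ L) (hv : π v ≠ 0) (z : V) :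
    {t : ℝ | ¬ HasLineDerivAt ℝ (cylinderProfileDeriv π a L e A B v)
      (cylinderProfileDeriv₂ π a L e A B v (z + t • v)) (z + t • v) v}.Countable := by
  have hlevel (c : ℝ) : {t : ℝ | ‖π (z + t • v) - a‖ ^ 2 = c}.Countable := by
    simpa only [map_add, map_smul, add_sub_right_comm] using
      (finite_setOf_norm_add_smul_sq_eq (π z - a) hv c).countable
  refine ((hlevel A).union (hlevel B)).mono fun t ht => ?_
  contrapose! ht
  simp only [mem_union, mem_ofPred_eq, not_or] at ht
  exact not_not.2 (hasLineDerivAt_cylinderProfileDeriv he hA hAB hL ht.1 ht.2)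

theorem sum_cylinderProfileDeriv₂ {ι : Type*} [Fintype ι] (b : OrthonormalBasis ι ℝ F)
    {v : ι → V} (hv : ∀ i, π (v i) = b i) (he : 0 < e) (hcard : 2 * e = Fintype.card ι) (hA : 0 < A)
    (hAB : A ≤ B) (z : V) :
    ∑ i, cylinderProfileDeriv₂ π a L e A B (v i) z =
      (L ∩ {z | ‖π z - a‖ ^ 2 < B}).indicator (fun _ => B ^ (-e)) z -
        (L ∩ {z | ‖π z - a‖ ^ 2 < A}).indicator (fun _ => A ^ (-e)) z := by
  by_cases hz : z ∈ L
  · have hsum := b.sum_sq_inner_right (π z - a)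
    have hlap := radialProfile_laplacian he hA hAB (‖π z - a‖ ^ 2)
    simp only [indicator, mem_Iio] at hlap
    simp only [cylinderProfileDeriv₂, indicator, hz, if_true, mem_inter_iff, true_and,
      mem_ofPred_eq, hv, b.norm_eq_one, Finset.sum_add_distrib, ← hlap, mul_pow, ← Finset.mul_sum,
      Finset.sum_const, Finset.card_univ, nsmul_eq_mul, ← hcard]
    simp only [real_inner_comm] at hsum ⊢
    rw [hsum]
    ring
  · simp [cylinderProfileDeriv₂, hz]

variable [MeasurableSpace V] [BorelSpace V] {μ : Measure V}

theorem integrable_mul_cylinderProfile (hA : 0 < A) (hAB : A ≤ B) (hL : MeasurableSet L)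
    (hK : IsCompact K) (hLK : L ∩ {z | ‖π z - a‖ ^ 2 < B} ⊆ K) {f : V → ℝ}
    (hf : IntegrableOn f K μ) : Integrable (fun z => cylinderProfile π a L e A B z * f z) μ := by
  have hcont : Continuous fun z => radialProfile e A B (‖π z - a‖ ^ 2) :=
    (continuous_radialProfile hA hAB).comp (by fun_prop)
  have h_int := ((hf.continuousOn_mul hcont.continuousOn hK).indicator hL).congr_fun
    (g := fun z => cylinderProfile π a L e A B z * f z)
    (fun z _ => indicator_mul_left L _ f) hK.measurableSet
  rwa [integrableOn_iff_integrable_of_support_subset] at h_int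
  intro z hz
  by_contra hzK
  exact hz (mul_eq_zero_of_left (cylinderProfile_eq_zero hAB hLK hzK) _)

theorem integrable_mul_cylinderProfileDeriv₂ (hA : 0 < A) (hAB : A ≤ B) (hL : MeasurableSet L)
    (hK : IsCompact K) (hLK : L ∩ {z | ‖π z - a‖ ^ 2 < B} ⊆ K) {f : V → ℝ}
    (hf : IntegrableOn f K μ) :
    Integrable (fun z => f z * cylinderProfileDeriv₂ π a L e A B v z) μ := by
  have hsq : Continuous fun z => ‖π z - a‖ ^ 2 := by fun_prop
  have hderiv : Continuous fun z => radialProfileDeriv e A B (‖π z - a‖ ^ 2) * (2 * ‖π v‖ ^ 2) :=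
    ((continuous_radialProfileDeriv hA hAB).comp hsq).mul_const _
  have hderiv₂ : Continuous fun z => max A (‖π z - a‖ ^ 2) ^ (-e - 1) / 4 *
      (2 * inner ℝ (π z - a) (π v)) ^ 2 :=
    (((continuous_max_rpow hA _).comp hsq).div_const 4).mul (by fun_prop)
  have hmeas : MeasurableSet ((fun z => ‖π z - a‖ ^ 2) ⁻¹' Ico A B) :=
    hsq.measurable measurableSet_Ico
  have h_int := ((((hf.mul_continuousOn hderiv₂.continuousOn hK).indicator hmeas).add
    (hf.mul_continuousOn hderiv.continuousOn hK)).indicator hL).congr_fun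
    (g := fun z => f z * cylinderProfileDeriv₂ π a L e A B v z) (fun z _ => by
      by_cases hzL : z ∈ L <;> by_cases hz : ‖π z - a‖ ^ 2 ∈ Ico A B <;>
      simp [cylinderProfileDeriv₂, radialProfileDeriv₂, hzL, hz, mul_add]) hK.measurableSet
  rwa [integrableOn_iff_integrable_of_support_subset] at h_int
  intro z hz
  by_contra hzK
  exact hz (mul_eq_zero_of_right _ (cylinderProfileDeriv₂_eq_zero hAB hLK hzK))

variable [FiniteDimensional ℝ V] [μ.IsAddHaarMeasure] {E : Set V} {w : V → ℝ}

theorem integral_mul_cylinderProfileDeriv₂ {w₁ w₂ : V → ℝ} (he : 0 < e) (hA : 0 < A) (hAB : A ≤ B)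
    (hE : Measure.hausdorffMeasure ((finrank ℝ V : ℝ) - 1) E = 0) (hv : π v ≠ 0)
    (hL : MeasurableSet L) (hLv : ∀ z, ∀ t : ℝ, z + t • v ∈ L ↔ z ∈ L) (hK : IsCompact K)
    (hLK : L ∩ {z | ‖π z - a‖ ^ 2 < B} ⊆ K) (hw : ∀ z ∈ K \ E, HasLineDerivAt ℝ w (w₁ z) z v)
    (hw₁ : ∀ z ∈ K \ E, HasLineDerivAt ℝ w₁ (w₂ z) z v) (hwK : IntegrableOn w K μ)
    (hw₂K : IntegrableOn w₂ K μ) :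
    ∫ z, w z * cylinderProfileDeriv₂ π a L e A B v z ∂μ =
      ∫ z, cylinderProfile π a L e A B z * w₂ z ∂μ := by
  have hsupp : Function.support (cylinderProfile π a L e A B) ⊆ K := fun z hz => by
    by_contra hzK
    exact hz (cylinderProfile_eq_zero hAB hLK hzK)
  have htsupp : tsupport (cylinderProfile π a L e A B) \ E ⊆ K \ E :=
    sdiff_subset_sdiff_left (closure_minimal hsupp hK.isClosed)
  exact integral_mul_eq_integral_mul_of_hasLineDerivAt (fun h => hv (by rw [h, map_zero])) hE
    (fun z hz => hw z (htsupp hz)) (fun z hz => hw₁ z (htsupp hz))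
    (hasLineDerivAt_cylinderProfile hA hAB hLv) (continuous_cylinderProfileDeriv_line hA hAB hLv)
    (countable_not_hasLineDerivAt_cylinderProfileDeriv he hA hAB hLv hv)
    (.of_support_subset_isCompact hK hsupp)
    (integrable_mul_cylinderProfileDeriv₂ hA hAB hL hK hLK hwK)
    (integrable_mul_cylinderProfile hA hAB hL hK hLK hw₂K)

variable {ι : Type*} [Fintype ι] (b : OrthonormalBasis ι ℝ F) {v : ι → V} {w₁ w₂ : ι → V → ℝ}

theorem integral_sub_integral_eq_integral_cylinderProfile (hv : ∀ i, π (v i) = b i) (he : 0 < e)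
    (hcard : 2 * e = Fintype.card ι) (hA : 0 < A) (hAB : A ≤ B)
    (hE : Measure.hausdorffMeasure ((finrank ℝ V : ℝ) - 1) E = 0) (hL : MeasurableSet L)
    (hLv : ∀ i z, ∀ t : ℝ, z + t • v i ∈ L ↔ z ∈ L) (hK : IsCompact K)
    (hLK : L ∩ {z | ‖π z - a‖ ^ 2 < B} ⊆ K)
    (hw : ∀ i, ∀ z ∈ K \ E, HasLineDerivAt ℝ w (w₁ i z) z (v i))
    (hw₁ : ∀ i, ∀ z ∈ K \ E, HasLineDerivAt ℝ (w₁ i) (w₂ i z) z (v i)) (hwK : IntegrableOn w K μ)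
    (hw₂K : ∀ i, IntegrableOn (w₂ i) K μ) :
    B ^ (-e) * ∫ z in L ∩ {z | ‖π z - a‖ ^ 2 < B}, w z ∂μ -
      A ^ (-e) * ∫ z in L ∩ {z | ‖π z - a‖ ^ 2 < A}, w z ∂μ =
    ∫ z, cylinderProfile π a L e A B z * ∑ i, w₂ i z ∂μ := by
  have hmeas (C : ℝ) : MeasurableSet (L ∩ {z | ‖π z - a‖ ^ 2 < C}) :=
    hL.inter (isOpen_lt (by fun_prop) continuous_const).measurableSet
  have hwC {C : ℝ} (hC : C ≤ B) : Integrable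
      (fun z => C ^ (-e) * (L ∩ {z | ‖π z - a‖ ^ 2 < C}).indicator w z) μ :=
    ((hwK.mono_set (.trans (inter_subset_inter_right L fun z (hz : _ < C) => hz.trans_le hC) hLK)
      ).integrable_indicator (hmeas C)).const_mul _
  calc _ = ∫ z, ∑ i, w z * cylinderProfileDeriv₂ π a L e A B (v i) z ∂μ := by
        rw [← integral_indicator (hmeas B), ← integral_indicator (hmeas A), ← integral_const_mul,
          ← integral_const_mul, ← integral_sub (hwC le_rfl) (hwC hAB)]
        congr 1 with z
        rw [← Finset.mul_sum, sum_cylinderProfileDeriv₂ b hv he hcard hA hAB]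
        simp only [indicator]
        split_ifs <;> ring
    _ = ∑ i, ∫ z, w z * cylinderProfileDeriv₂ π a L e A B (v i) z ∂μ :=
        integral_finsetSum _ fun i _ => integrable_mul_cylinderProfileDeriv₂ hA hAB hL hK hLK hwK
    _ = ∑ i, ∫ z, cylinderProfile π a L e A B z * w₂ i z ∂μ :=
        Finset.sum_congr rfl fun i _ => integral_mul_cylinderProfileDeriv₂ he hA hAB hE
          (hv i ▸ b.orthonormal.ne_zero i) hL (hLv i) hK hLK (hw i) (hw₁ i) hwK (hw₂K i)
    _ = _ := by
        rw [← integral_finsetSum _ fun i _ =>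
          integrable_mul_cylinderProfile hA hAB hL hK hLK (hw₂K i)]
        simp only [Finset.mul_sum]

theorem sq_rpow_neg_half {r : ℝ} (hr : 0 ≤ r) (n : ℕ) :
    (r ^ 2) ^ (-((n : ℝ) / 2)) = (r ^ n)⁻¹ := by
  rw [← Real.rpow_natCast_mul hr, ← Real.rpow_natCast, ← Real.rpow_neg hr]
  congr 1
  push_cast
  ring

theorem inv_pow_mul_setIntegral_mono (hv : ∀ i, π (v i) = b i)
    (hE : Measure.hausdorffMeasure ((finrank ℝ V : ℝ) - 1) E = 0) (hL : MeasurableSet L)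
    (hLv : ∀ i z, ∀ t : ℝ, z + t • v i ∈ L ↔ z ∈ L) (hK : IsCompact K) {r₁ r₂ : ℝ} (hr₁ : 0 < r₁)
    (hr : r₁ ≤ r₂) (hLK : L ∩ π ⁻¹' Metric.ball a r₂ ⊆ K)
    (hw : ∀ i, ∀ z ∈ K \ E, HasLineDerivAt ℝ w (w₁ i z) z (v i))
    (hw₁ : ∀ i, ∀ z ∈ K \ E, HasLineDerivAt ℝ (w₁ i) (w₂ i z) z (v i)) (hwK : IntegrableOn w K μ)
    (hw₂K : ∀ i, IntegrableOn (w₂ i) K μ) (hΔ : ∀ z ∈ K \ E, 0 ≤ ∑ i, w₂ i z) :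
    (r₁ ^ Fintype.card ι)⁻¹ * ∫ z in L ∩ π ⁻¹' Metric.ball a r₁, w z ∂μ ≤
      (r₂ ^ Fintype.card ι)⁻¹ * ∫ z in L ∩ π ⁻¹' Metric.ball a r₂, w z ∂μ := by
  have hr₂ := hr₁.trans_le hr
  have hball {r : ℝ} (hr : 0 < r) : π ⁻¹' Metric.ball a r = {z | ‖π z - a‖ ^ 2 < r ^ 2} := by
    ext z
    simp [dist_eq_norm, sq_lt_sq₀ (norm_nonneg _) hr.le]
  rcases isEmpty_or_nonempty ι with hι | ⟨⟨i₀⟩⟩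
  · have : Subsingleton F := b.repr.toEquiv.subsingleton
    have huniv {r : ℝ} (hr : 0 < r) : Metric.ball a r = univ :=
      Subsingleton.eq_univ_of_nonempty ⟨a, Metric.mem_ball_self hr⟩
    simp [huniv hr₁, huniv hr₂]
  have he : 0 < (Fintype.card ι : ℝ) / 2 := by
    have : 0 < Fintype.card ι := Fintype.card_pos_iff.2 ⟨i₀⟩
    positivity
  have hA : 0 < r₁ ^ 2 := by positivity
  have hAB : r₁ ^ 2 ≤ r₂ ^ 2 := by gcongr
  rw [hball hr₂] at hLK
  rw [hball hr₁, hball hr₂, ← sq_rpow_neg_half hr₁.le, ← sq_rpow_neg_half hr₂.le, ← sub_nonneg,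
    integral_sub_integral_eq_integral_cylinderProfile b hv he (by ring) hA hAB hE hL hLv hK hLK
      hw hw₁ hwK hw₂K]
  have hvi₀ : v i₀ ≠ 0 := fun h => b.orthonormal.ne_zero i₀ (by rw [← hv, h, map_zero])
  refine integral_nonneg_of_ae ?_
  filter_upwards [ae_forall_add_smul_notMem μ hE hvi₀] with z hz
  by_cases hzK : z ∈ K
  · exact mul_nonneg (cylinderProfile_nonneg he hA hAB z) (hΔ z ⟨hzK, by simpa using hz 0⟩)
  · simp [cylinderProfile_eq_zero hAB hLK hzK]

end Cylinder

section BallAverage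

variable {F : Type*} [NormedAddCommGroup F] [NormedSpace ℝ F] [FiniteDimensional ℝ F]
  [MeasurableSpace F] [BorelSpace F] {μ : Measure F} [μ.IsAddHaarMeasure] {f : F → ℝ} {a : F}

theorem tendsto_setAverage_ball (hf : ContinuousAt f a) {R : ℝ} (hR : 0 < R)
    (hfR : IntegrableOn f (Metric.ball a R) μ) :
    Tendsto (fun r => ⨍ z in Metric.ball a r, f z ∂μ) (𝓝[>] 0) (𝓝 (f a)) := by
  refine Metric.nhds_basis_closedBall.tendsto_right_iff.2 fun ε hε => ?_
  obtain ⟨δ, hδ, hball⟩ := Metric.continuousAt_iff.1 hf ε hε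
  filter_upwards [Ioo_mem_nhdsGT (lt_min hδ hR)] with r hr
  refine (convex_closedBall (f a) ε).set_average_mem Metric.isClosed_closedBall
    (Metric.measure_ball_pos μ a hr.1).ne' measure_ball_lt_top.ne ?_
    (hfR.mono_set (Metric.ball_subset_ball (hr.2.le.trans (min_le_right _ _))))
  filter_upwards [ae_restrict_mem Metric.isOpen_ball.measurableSet] with z hz
  exact (hball ((Metric.mem_ball.1 hz).trans (hr.2.trans_le (min_le_left _ _)))).le

theorem measureReal_ball_eq_pow_mul (a : F) {r : ℝ} (hr : 0 < r) :
    μ.real (Metric.ball a r) = r ^ finrank ℝ F * μ.real (Metric.ball 0 1) := by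
  rw [measureReal_def, measureReal_def, Measure.addHaar_ball_of_pos μ a hr, ENNReal.toReal_mul,
    ENNReal.toReal_ofReal (by positivity)]

theorem setAverage_ball_eq_inv_pow_mul (f : F → ℝ) (a : F) {r : ℝ} (hr : 0 < r) :
    ⨍ z in Metric.ball a r, f z ∂μ =
      (μ.real (Metric.ball 0 1))⁻¹ * ((r ^ finrank ℝ F)⁻¹ * ∫ z in Metric.ball a r, f z ∂μ) := by
  rw [setAverage_eq, measureReal_ball_eq_pow_mul a hr, mul_inv, smul_eq_mul]
  ring

theorem setAverage_ball_prod_eq_inv_pow_mul {Y : Type*} [MeasurableSpace Y] {ν : Measure Y}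
    [SFinite ν] (u : F × Y → ℝ) (a : F) (T : Set Y) {r : ℝ} (hr : 0 < r) :
    ⨍ z in Metric.ball a r ×ˢ T, u z ∂(μ.prod ν) =
      ((μ.real (Metric.ball 0 1))⁻¹ * (ν.real T)⁻¹) *
        ((r ^ finrank ℝ F)⁻¹ * ∫ z in Metric.ball a r ×ˢ T, u z ∂(μ.prod ν)) := by
  rw [setAverage_eq, measureReal_prod_prod, measureReal_ball_eq_pow_mul a hr, mul_inv, mul_inv,
    smul_eq_mul]
  ring

end BallAverage

section Laplacian

variable {F ι : Type*} [NormedAddCommGroup F] [InnerProductSpace ℝ F] [FiniteDimensional ℝ F]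
  [MeasurableSpace F] [BorelSpace F] {μ : Measure F} [μ.IsAddHaarMeasure] [Fintype ι]

theorem le_setAverage_ball_of_sum_nonneg (b : OrthonormalBasis ι ℝ F) {f : F → ℝ}
    {f₁ f₂ : ι → F → ℝ} {a : F} {R : ℝ} (hR : 0 < R) (hfa : ContinuousAt f a)
    (hf : ∀ i, ∀ z ∈ Metric.closedBall a R, HasLineDerivAt ℝ f (f₁ i z) z (b i))
    (hf₁ : ∀ i, ∀ z ∈ Metric.closedBall a R, HasLineDerivAt ℝ (f₁ i) (f₂ i z) z (b i))
    (hfR : IntegrableOn f (Metric.closedBall a R) μ)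
    (hf₂R : ∀ i, IntegrableOn (f₂ i) (Metric.closedBall a R) μ)
    (hΔ : ∀ z ∈ Metric.closedBall a R, 0 ≤ ∑ i, f₂ i z) :
    f a ≤ ⨍ z in Metric.ball a R, f z ∂μ := by
  refine le_of_tendsto (tendsto_setAverage_ball hfa hR (hfR.mono_set Metric.ball_subset_closedBall))
    ?_
  filter_upwards [Ioo_mem_nhdsGT hR] with r hr
  have hmono := inv_pow_mul_setIntegral_mono (π := .id ℝ F) (a := a) (E := ∅) (L := univ) (v := b)
    b (fun _ => rfl) (measure_empty (μ := Measure.hausdorffMeasure _)) .univ (by simp)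
    (isCompact_closedBall a R) hr.1 hr.2.le (by simpa using Metric.ball_subset_closedBall)
    (by simpa only [sdiff_empty] using hf) (by simpa only [sdiff_empty] using hf₁) hfR hf₂R
    (by simpa only [sdiff_empty] using hΔ)
  rw [setAverage_ball_eq_inv_pow_mul f a hr.1, setAverage_ball_eq_inv_pow_mul f a hR,
    finrank_eq_card_basis b.toBasis]
  simp only [univ_inter] at hmono
  exact mul_le_mul_of_nonneg_left hmono (by positivity)

theorem setAverage_ball_norm_sub_sq_pos [Nontrivial F] (a : F) {r : ℝ} (hr : 0 < r) :
    0 < ⨍ z in Metric.ball a r, ‖z - a‖ ^ 2 ∂μ := by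
  have hcont : Continuous fun z => ‖z - a‖ ^ 2 := by fun_prop
  have h_int : IntegrableOn (fun z => ‖z - a‖ ^ 2) (Metric.ball a r) μ :=
    (hcont.continuousOn.integrableOn_compact (isCompact_closedBall a r)).mono_set
      Metric.ball_subset_closedBall
  have hsupp : Function.support (fun z => ‖z - a‖ ^ 2) = {a}ᶜ := by
    ext z
    simp [sub_eq_zero]
  have hvol := Metric.measure_ball_pos μ a hr
  rw [setAverage_eq, smul_eq_mul]
  refine mul_pos (inv_pos.2 (ENNReal.toReal_pos hvol.ne' measure_ball_lt_top.ne)) ?_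
  rw [setIntegral_pos_iff_support_of_nonneg_ae (ae_of_all _ fun z => sq_nonneg _) h_int, hsupp,
    inter_comm, ← sdiff_eq, measure_sdiff_null (measure_singleton a)]
  exact hvol

theorem setAverage_ball_lt_of_sum_le_neg (b : OrthonormalBasis ι ℝ F) {f : F → ℝ}
    {f₁ f₂ : ι → F → ℝ} {a : F} {c R : ℝ} (hc : 0 < c) (hR : 0 < R) (hfa : ContinuousAt f a)
    (hf : ∀ i, ∀ z ∈ Metric.closedBall a R, HasLineDerivAt ℝ f (f₁ i z) z (b i))
    (hf₁ : ∀ i, ∀ z ∈ Metric.closedBall a R, HasLineDerivAt ℝ (f₁ i) (f₂ i z) z (b i))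
    (hfR : IntegrableOn f (Metric.closedBall a R) μ)
    (hf₂R : ∀ i, IntegrableOn (f₂ i) (Metric.closedBall a R) μ)
    (hΔ : ∀ z ∈ Metric.closedBall a R, ∑ i, f₂ i z ≤ -c) :
    ⨍ z in Metric.ball a R, f z ∂μ < f a := by
  obtain ⟨i₀, -, -⟩ := Finset.exists_ne_zero_of_sum_ne_zero
    ((hΔ a (Metric.mem_closedBall_self hR.le)).trans_lt (neg_lt_zero.2 hc)).ne
  have : Nontrivial F := ⟨b i₀, 0, b.orthonormal.ne_zero i₀⟩
  have hcard : (0 : ℝ) < Fintype.card ι := Nat.cast_pos.2 (Fintype.card_pos_iff.2 ⟨i₀⟩)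
  obtain ⟨d, hd, hcd⟩ : ∃ d > 0, Fintype.card ι * (d * 2) = c :=
    ⟨c / (2 * Fintype.card ι), by positivity, by field_simp⟩
  have hinner (i : ι) (z : F) :
      HasLineDerivAt ℝ (fun z => 2 * inner ℝ (z - a) (b i)) 2 z (b i) := by
    simpa [HasLineDerivAt, b.orthonormal.1 i] using (hasLineDerivAt_inner_sub a z (b i)).const_mul 2
  have hball : Metric.ball a R ⊆ Metric.closedBall a R := Metric.ball_subset_closedBall
  have hsqR : IntegrableOn (fun z => d * ‖z - a‖ ^ 2) (Metric.closedBall a R) μ :=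
    Continuous.continuousOn (by fun_prop) |>.integrableOn_compact (isCompact_closedBall a R)
  have hle := le_setAverage_ball_of_sum_nonneg (μ := μ) (a := a) b
    (f := fun z => -(f z + d * ‖z - a‖ ^ 2))
    (f₁ := fun i z => -(f₁ i z + d * (2 * inner ℝ (z - a) (b i))))
    (f₂ := fun i z => -(f₂ i z + d * 2)) hR
    (hfa.add (by fun_prop)).neg
    (fun i z hz =>
      ((hf i z hz).fun_add ((hasLineDerivAt_norm_sub_sq a z (b i)).const_mul d)).fun_neg)
    (fun i z hz => ((hf₁ i z hz).fun_add ((hinner i z).const_mul d)).fun_neg)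
    (hfR.add hsqR).neg
    (fun i => ((hf₂R i).add (integrableOn_const (isCompact_closedBall a R).measure_lt_top.ne)).neg)
    (fun z hz => by simpa [Finset.sum_add_distrib, hcd] using hΔ z hz)
  have hpos : 0 < d * ⨍ z in Metric.ball a R, ‖z - a‖ ^ 2 ∂μ :=
    mul_pos hd (setAverage_ball_norm_sub_sq_pos a hR)
  rw [average_neg, average, integral_add (hfR.mono_set hball).to_average
    (hsqR.mono_set hball).to_average, integral_const_mul, ← average, ← average, sub_self, norm_zero]
    at hle
  linarith

end Laplacian

section SmoothSubharmonic

variable {n : ℕ} {U : Set (EuclideanSpace ℝ (Fin n))} {f : EuclideanSpace ℝ (Fin n) → ℝ}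

theorem contDiffOn_partialDeriv {m : WithTop ℕ∞} (hU : IsOpen U) (hf : ContDiffOn ℝ (m + 1) f U)
    (i : Fin n) : ContDiffOn ℝ m (partialDeriv i f) U := by
  have hfderiv : ContDiffOn ℝ m (fun z => fderiv ℝ f z (EuclideanSpace.single i 1)) U :=
    (hf.fderiv_of_isOpen hU le_rfl).clm_apply contDiffOn_const
  refine hfderiv.congr fun z hz => ?_
  exact ((hf.contDiffAt (hU.mem_nhds hz)).differentiableAt (by simp)).lineDeriv_eq_fderiv

theorem hasLineDerivAt_partialDeriv (hU : IsOpen U) (hf : ContDiffOn ℝ 1 f U) (i : Fin n)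
    {z : EuclideanSpace ℝ (Fin n)} (hz : z ∈ U) :
    HasLineDerivAt ℝ f (partialDeriv i f z) z (EuclideanSpace.single i 1) :=
  have hdiff := (hf.contDiffAt (hU.mem_nhds hz)).differentiableAt one_ne_zero
  hdiff.lineDifferentiableAt.hasLineDerivAt

theorem ballMean_coe {a : EuclideanSpace ℝ (Fin n)} {r : ℝ} (hr : 0 < r)
    (hf : IntegrableOn f (Metric.ball a r)) :
    ballMean (fun z => (f z : EReal)) a r = ((⨍ z in Metric.ball a r, f z : ℝ) : EReal) := by
  have hne_top {g : EuclideanSpace ℝ (Fin n) → ℝ} (hg : IntegrableOn g (Metric.ball a r)) :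
      (⨍⁻ z in Metric.ball a r, ENNReal.ofReal (g z) ∂volume) ≠ ⊤ := by
    rw [setLAverage_eq]
    exact ENNReal.div_ne_top hg.lintegral_lt_top.ne (Metric.measure_ball_pos volume a hr).ne'
  simp only [ballMean, ← EReal.coe_neg, EReal.toENNReal_of_ne_top (EReal.coe_ne_top _),
    EReal.toReal_coe]
  rw [← EReal.coe_ennreal_toReal (hne_top hf),
    ← EReal.coe_ennreal_toReal (hne_top (g := fun z => -f z) hf.neg), ← EReal.coe_sub]
  congr 1
  rw [setAverage_eq, integral_eq_lintegral_pos_part_sub_lintegral_neg_part hf, setLAverage_eq,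
    setLAverage_eq, ENNReal.toReal_div, ENNReal.toReal_div, smul_eq_mul, measureReal_def]
  ring

theorem SubharmonicOn.laplacian_nonneg (hU : IsOpen U) (hf : ContDiffOn ℝ 2 f U)
    (hsub : SubharmonicOn (fun z => (f z : EReal)) U) {a : EuclideanSpace ℝ (Fin n)}
    (ha : a ∈ U) : 0 ≤ ∑ i, partialDeriv i (partialDeriv i f) a := by
  by_contra! hneg
  have hf₁ (i : Fin n) : ContDiffOn ℝ 1 (partialDeriv i f) U := contDiffOn_partialDeriv hU hf i
  have hf₂ (i : Fin n) : ContinuousOn (partialDeriv i (partialDeriv i f)) U :=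
    (contDiffOn_partialDeriv (m := 0) hU (hf₁ i) i).continuousOn
  obtain ⟨c, hΔa, hc⟩ := exists_between hneg
  obtain ⟨R, hR, hRU⟩ := Metric.nhds_basis_closedBall.mem_iff.1
    (inter_mem (hU.mem_nhds ha) (((continuousOn_finsetSum Finset.univ fun i _ => hf₂ i).continuousAt
      (hU.mem_nhds ha)).preimage_mem_nhds (Iio_mem_nhds hΔa)))
  have hRU₁ : Metric.closedBall a R ⊆ U := fun z hz => (hRU hz).1
  have hfR : IntegrableOn f (Metric.closedBall a R) :=
    (hf.continuousOn.mono hRU₁).integrableOn_compact (isCompact_closedBall a R)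
  have hlt : ⨍ z in Metric.ball a R, f z < f a :=
    setAverage_ball_lt_of_sum_le_neg (EuclideanSpace.basisFun (Fin n) ℝ) (neg_pos.2 hc) hR
      (hf.continuousOn.continuousAt (hU.mem_nhds ha))
      (fun i z hz => by
        simpa using hasLineDerivAt_partialDeriv hU (hf.of_le one_le_two) i (hRU₁ hz))
      (fun i z hz => by simpa using hasLineDerivAt_partialDeriv hU (hf₁ i) i (hRU₁ hz)) hfR
      (fun i => ((hf₂ i).mono hRU₁).integrableOn_compact (isCompact_closedBall a R))
      (fun z hz => by simpa using (hRU hz).2.le)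
  have hle := hsub.le_ballMean a R hR hRU₁
  rw [ballMean_coe hR (hfR.mono_set Metric.ball_subset_closedBall), EReal.coe_le_coe_iff] at hle
  exact hle.not_gt hlt

end SmoothSubharmonic

section ProductAverage

variable {X Y : Type*} [MeasurableSpace X] [MeasurableSpace Y] {μ : Measure X} {ν : Measure Y}
  [SFinite μ] [SFinite ν]

theorem setAverage_prod_eq {u : X × Y → ℝ} {S : Set X} {T : Set Y}
    (hu : IntegrableOn u (S ×ˢ T) (μ.prod ν)) :
    ⨍ z in S ×ˢ T, u z ∂(μ.prod ν) = ⨍ x in S, ⨍ y in T, u (x, y) ∂ν ∂μ := by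
  simp only [setAverage_eq, smul_eq_mul, integral_const_mul]
  rw [measureReal_prod_prod, setIntegral_prod u hu]
  ring

theorem setAverage_prod_swap (u : X × Y → ℝ) (S : Set X) (T : Set Y) :
    ⨍ z in T ×ˢ S, u z.swap ∂(ν.prod μ) = ⨍ z in S ×ˢ T, u z ∂(μ.prod ν) := by
  rw [setAverage_eq, setAverage_eq, measureReal_prod_prod, measureReal_prod_prod, mul_comm,
    setIntegral_prod_swap]

theorem setAverage_setAverage_swap {u : X × Y → ℝ} {S : Set X} {T : Set Y}
    (hu : IntegrableOn u (S ×ˢ T) (μ.prod ν)) :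
    ⨍ x in S, ⨍ y in T, u (x, y) ∂ν ∂μ = ⨍ y in T, ⨍ x in S, u (x, y) ∂μ ∂ν := by
  rw [← setAverage_prod_eq hu, ← setAverage_prod_swap, setAverage_prod_eq]
  · rfl
  · rw [IntegrableOn, ← Measure.prod_restrict] at hu ⊢
    exact hu.swap

theorem integrableOn_setAverage_prod {u : X × Y → ℝ} {S : Set X} {T : Set Y}
    (hu : IntegrableOn u (S ×ˢ T) (μ.prod ν)) :
    IntegrableOn (fun x => ⨍ y in T, u (x, y) ∂ν) S μ := by
  simp only [setAverage_eq, smul_eq_mul]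
  rw [IntegrableOn, ← Measure.prod_restrict] at hu
  exact hu.integral_prod_left.const_mul _

end ProductAverage

section IteratedBallAverage

theorem setAverage_ball_eq_setAverage_ball_zero {F : Type*} [NormedAddCommGroup F]
    [MeasurableSpace F] [BorelSpace F] {μ : Measure F} [μ.IsAddLeftInvariant] (f : F → ℝ) (a : F)
    (r : ℝ) :
    ⨍ z in Metric.ball a r, f z ∂μ = ⨍ h in Metric.ball 0 r, f (a + h) ∂μ := by
  have hball : (a + ·) ⁻¹' Metric.ball a r = Metric.ball 0 r := by ext h; simp
  rw [setAverage_eq, setAverage_eq, ← hball, (measurePreserving_add_left μ a).measureReal_preimage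
    Metric.isOpen_ball.measurableSet.nullMeasurableSet,
    (measurePreserving_add_left μ a).setIntegral_preimage_emb (measurableEmbedding_addLeft a)]

variable {F : Type*} [NormedAddCommGroup F] [NormedSpace ℝ F] [FiniteDimensional ℝ F]
  [MeasurableSpace F] [BorelSpace F] {μ : Measure F} [μ.IsAddHaarMeasure] {f : F → ℝ} {a : F}
  {r s R : ℝ}

theorem continuousAt_setAverage_ball (hr : 0 < r) (hrR : r < R)
    (hf : IntegrableOn f (Metric.ball a R) μ) :
    ContinuousAt (fun x => ⨍ z in Metric.ball x r, f z ∂μ) a := by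
  have hnear : ∀ᶠ x in 𝓝 a, Metric.ball x r ⊆ Metric.ball a R := by
    filter_upwards [Metric.ball_mem_nhds a (sub_pos.2 hrR)] with x hx
    exact Metric.ball_subset_ball' (by linarith [Metric.mem_ball.1 hx])
  have hmeas : ∀ x : F, MeasurableSet (Metric.ball x r) := fun _ => Metric.isOpen_ball.measurableSet
  simp only [setAverage_ball_eq_inv_pow_mul f _ hr, ← integral_indicator (hmeas _)]
  refine continuousAt_const.mul (continuousAt_const.mul ?_)
  refine continuousAt_of_dominated (bound := (Metric.ball a R).indicator fun z => ‖f z‖)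
    ?_ ?_ (IntegrableOn.integrable_indicator hf.norm Metric.isOpen_ball.measurableSet) ?_
  · filter_upwards [hnear] with x hx
    exact ((hf.mono_set hx).integrable_indicator (hmeas x)).aestronglyMeasurable
  · filter_upwards [hnear] with x hx
    refine ae_of_all _ fun z => ?_
    rw [norm_indicator_eq_indicator_norm]
    exact indicator_le_indicator_of_subset hx (fun _ => norm_nonneg _) z
  · filter_upwards [measure_eq_zero_iff_ae_notMem.1
      (Measure.addHaar_sphere_of_ne_zero μ a hr.ne')] with z hz
    have hdist : Continuous fun x => dist z x := by fun_prop
    rcases lt_or_gt_of_ne hz with hlt | hgt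
    · refine continuousAt_const.congr (f := fun _ => f z) ?_
      filter_upwards [hdist.continuousAt.eventually_lt_const hlt] with x hx
      rw [indicator_of_mem (Metric.mem_ball.2 hx)]
    · refine continuousAt_const.congr (f := fun _ => (0 : ℝ)) ?_
      filter_upwards [hdist.continuousAt.eventually_const_lt hgt] with x hx
      rw [indicator_of_notMem (mt Metric.mem_ball.1 hx.not_gt)]

theorem integrableOn_comp_add_prod {S T : Set F} (hf : Integrable f μ) (hS : μ S ≠ ⊤) :
    IntegrableOn (fun z : F × F => f (z.1 + z.2)) (S ×ˢ T) (μ.prod μ) := by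
  have : IsFiniteMeasure (μ.restrict S) := isFiniteMeasure_restrict.2 hS
  have hsnd : Integrable (fun z : F × F => f z.2) ((μ.restrict S).prod μ) := hf.comp_snd _
  have hadd := (measurePreserving_prod_add (μ.restrict S) μ).integrable_comp_of_integrable hsnd
  rw [IntegrableOn, ← Measure.prod_restrict]
  exact hadd.mono_measure (Measure.prod_mono le_rfl Measure.restrict_le_self)

theorem setAverage_ball_setAverage_ball_comm (hR : s + r ≤ R)
    (hf : IntegrableOn f (Metric.ball a R) μ) :
    ⨍ x in Metric.ball a s, ⨍ z in Metric.ball x r, f z ∂μ ∂μ =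
      ⨍ x in Metric.ball a r, ⨍ z in Metric.ball x s, f z ∂μ ∂μ := by
  have htranslate : ∀ s r, ⨍ x in Metric.ball a s, ⨍ z in Metric.ball x r, f z ∂μ ∂μ =
      ⨍ h in Metric.ball 0 s, ⨍ k in Metric.ball 0 r, f (a + h + k) ∂μ ∂μ := fun s r => by
    rw [setAverage_ball_eq_setAverage_ball_zero]
    simp_rw [setAverage_ball_eq_setAverage_ball_zero f (a + _) r]
  have hg := (measurePreserving_add_left μ a).integrable_comp_of_integrable
    (hf.integrable_indicator Metric.isOpen_ball.measurableSet)
  have h_int : IntegrableOn (fun z : F × F => f (a + z.1 + z.2))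
      (Metric.ball 0 s ×ˢ Metric.ball 0 r) (μ.prod μ) := by
    refine (integrableOn_comp_add_prod hg measure_ball_lt_top.ne).congr_fun (fun z hz => ?_)
      (Metric.isOpen_ball.prod Metric.isOpen_ball).measurableSet
    have hz' : a + (z.1 + z.2) ∈ Metric.ball a R := by
      simp only [mem_prod, mem_ball_zero_iff] at hz
      simpa using (norm_add_le _ _).trans_lt (by linarith)
    simp [indicator_of_mem hz', add_assoc]
  rw [htranslate, htranslate, setAverage_setAverage_swap h_int]
  simp only [add_right_comm]

theorem integrableOn_setAverage_ball (hr : 0 < r) (hR : s + r < R)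
    (hf : IntegrableOn f (Metric.ball a R) μ) :
    IntegrableOn (fun x => ⨍ z in Metric.ball x r, f z ∂μ) (Metric.ball a s) μ := by
  refine IntegrableOn.mono_set (ContinuousOn.integrableOn_compact
    (isCompact_closedBall a s) fun x hx => ?_) Metric.ball_subset_closedBall
  refine (continuousAt_setAverage_ball (R := R - s) hr (by linarith)
    (hf.mono_set (Metric.ball_subset_ball' ?_))).continuousWithinAt
  linarith [Metric.mem_closedBall.1 hx]

theorem setAverage_ball_le_setAverage_setAverage_ball (hr : 0 < r) (hs : 0 < s) (hR : s + r < R)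
    (hf : IntegrableOn f (Metric.ball a R) μ)
    (hmono : ∀ x r₁ r₂, 0 < r₁ → r₁ ≤ r₂ → Metric.closedBall x r₂ ⊆ Metric.ball a R →
      ⨍ z in Metric.ball x r₁, f z ∂μ ≤ ⨍ z in Metric.ball x r₂, f z ∂μ) :
    ⨍ z in Metric.ball a r, f z ∂μ ≤
      ⨍ x in Metric.ball a s, ⨍ z in Metric.ball x r, f z ∂μ ∂μ := by
  refine le_of_tendsto (tendsto_setAverage_ball (μ := μ)
    (continuousAt_setAverage_ball hr (by linarith) hf) hs
    (integrableOn_setAverage_ball hr hR hf)) ?_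
  filter_upwards [Ioo_mem_nhdsGT hs] with t ht
  rw [setAverage_ball_setAverage_ball_comm (R := R) (by linarith [ht.2]) hf,
    setAverage_ball_setAverage_ball_comm hR.le hf, setAverage_eq, setAverage_eq]
  refine mul_le_mul_of_nonneg_left ?_ (by positivity)
  refine setIntegral_mono_on (integrableOn_setAverage_ball ht.1 (by linarith [ht.2]) hf)
    (integrableOn_setAverage_ball hs (by linarith) hf) Metric.isOpen_ball.measurableSet
    fun x hx => hmono x t s ht.1 ht.2.le (Metric.closedBall_subset_ball' ?_)
  linarith [Metric.mem_ball.1 hx]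

theorem setAverage_ball_prod_le_setAverage_setAverage {Y : Type*} [MeasurableSpace Y]
    {ν : Measure Y} [SFinite ν] {u : F × Y → ℝ} {T : Set Y} (hr : 0 < r) (hs : 0 < s)
    (hR : s + r < R) (hu : IntegrableOn u (Metric.ball a R ×ˢ T) (μ.prod ν))
    (hmono : ∀ x r₁ r₂, 0 < r₁ → r₁ ≤ r₂ → Metric.closedBall x r₂ ⊆ Metric.ball a R →
      ⨍ z in Metric.ball x r₁ ×ˢ T, u z ∂(μ.prod ν) ≤
        ⨍ z in Metric.ball x r₂ ×ˢ T, u z ∂(μ.prod ν)) :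
    ⨍ z in Metric.ball a r ×ˢ T, u z ∂(μ.prod ν) ≤
      ⨍ x in Metric.ball a s, ⨍ z in Metric.ball x r ×ˢ T, u z ∂(μ.prod ν) ∂μ := by
  have hfubini : ∀ {x ρ}, Metric.ball x ρ ⊆ Metric.ball a R →
      ⨍ z in Metric.ball x ρ ×ˢ T, u z ∂(μ.prod ν) =
        ⨍ x in Metric.ball x ρ, ⨍ y in T, u (x, y) ∂ν ∂μ := fun h =>
    setAverage_prod_eq (hu.mono_set (prod_mono_left h))
  have hsub := setAverage_ball_le_setAverage_setAverage_ball hr hs hR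
    (integrableOn_setAverage_prod hu) fun x r₁ r₂ h₁ h₁₂ hx => by
      have hr₂ := Metric.ball_subset_closedBall.trans hx
      rw [← hfubini hr₂, ← hfubini ((Metric.ball_subset_ball h₁₂).trans hr₂)]
      exact hmono x r₁ r₂ h₁ h₁₂ hx
  rw [hfubini (Metric.ball_subset_ball (by linarith))]
  refine hsub.trans_eq (setAverage_congr_fun Metric.isOpen_ball.measurableSet
    (ae_of_all _ fun x hx => (hfubini (Metric.ball_subset_ball' ?_)).symm))
  linarith [Metric.mem_ball.1 hx]

end IteratedBallAverage

section MeanEnvelope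

variable {Z : Type*} [PseudoMetricSpace Z] [MeasurableSpace Z] {μ : Measure Z} {u : Z → ℝ}
  {U : Set Z} {z : Z}

/-- The infimum of the averages of `u` over the balls centred at `z` whose closure lies in `U`:
the candidate for the extension of `u` to `U`. The value `⊤` occurs only where there is no such
ball. -/
noncomputable def meanEnvelope (μ : Measure Z) (u : Z → ℝ) (U : Set Z) (z : Z) : EReal :=
  ⨅ r : {r : ℝ // 0 < r ∧ Metric.closedBall z r ⊆ U},
    ((⨍ x in Metric.ball z r, u x ∂μ : ℝ) : EReal)

/-- The averages of `u` over concentric balls whose closures lie in `U` increase with the radius. -/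
def BallMeansMono (μ : Measure Z) (u : Z → ℝ) (U : Set Z) : Prop :=
  ∀ z r₁ r₂, 0 < r₁ → r₁ ≤ r₂ → Metric.closedBall z r₂ ⊆ U →
    ⨍ x in Metric.ball z r₁, u x ∂μ ≤ ⨍ x in Metric.ball z r₂, u x ∂μ

theorem meanEnvelope_le {r : ℝ} (hr : 0 < r) (hz : Metric.closedBall z r ⊆ U) :
    meanEnvelope μ u U z ≤ ((⨍ x in Metric.ball z r, u x ∂μ : ℝ) : EReal) :=
  iInf_le (fun r : {r : ℝ // 0 < r ∧ Metric.closedBall z r ⊆ U} =>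
    ((⨍ x in Metric.ball z r, u x ∂μ : ℝ) : EReal)) ⟨r, hr, hz⟩

theorem meanEnvelope_lt_top (hU : IsOpen U) (hz : z ∈ U) : meanEnvelope μ u U z < ⊤ := by
  obtain ⟨r, hr, hrU⟩ := Metric.nhds_basis_closedBall.mem_iff.1 (hU.mem_nhds hz)
  exact (meanEnvelope_le hr hrU).trans_lt (EReal.coe_lt_top _)

theorem meanEnvelope_eq_iInf (hmono : BallMeansMono μ u U) {ε : ℕ → ℝ} (hε : ∀ k, 0 < ε k)
    (hlim : Tendsto ε atTop (𝓝 0)) (hεU : ∀ k, Metric.closedBall z (ε k) ⊆ U) :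
    meanEnvelope μ u U z = ⨅ k, ((⨍ x in Metric.ball z (ε k), u x ∂μ : ℝ) : EReal) := by
  refine le_antisymm (le_iInf fun k => meanEnvelope_le (hε k) (hεU k)) (le_iInf fun r => ?_)
  obtain ⟨k, hk⟩ := (hlim.eventually_lt_const r.2.1).exists
  exact (iInf_le _ k).trans (EReal.coe_le_coe_iff.2 (hmono z _ _ (hε k) hk.le r.2.2))

theorem integrableOn_ball_of_closedBall_subset [ProperSpace Z] (hu : LocallyIntegrableOn u U μ)
    {r : ℝ} (hr : Metric.closedBall z r ⊆ U) : IntegrableOn u (Metric.ball z r) μ :=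
  ((hu.mono_set hr).integrableOn_isCompact (isCompact_closedBall _ _)).mono_set
    Metric.ball_subset_closedBall

end MeanEnvelope

section HaarMeanEnvelope

variable {Z : Type*} [NormedAddCommGroup Z] [NormedSpace ℝ Z] [FiniteDimensional ℝ Z]
  [MeasurableSpace Z] [BorelSpace Z] {μ : Measure Z} [μ.IsAddHaarMeasure] {u : Z → ℝ} {U : Set Z}
  {z : Z}

theorem upperSemicontinuousAt_meanEnvelope (hU : IsOpen U) (hu : LocallyIntegrableOn u U μ) :
    UpperSemicontinuousAt (meanEnvelope μ u U) z := by
  intro c hc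
  rw [meanEnvelope, iInf_lt_iff] at hc
  obtain ⟨⟨r, hr, hrU⟩, hlt⟩ := hc
  obtain ⟨δ, hδ, hδU⟩ := (isCompact_closedBall z r).exists_cthickening_subset_open hU hrU
  rw [cthickening_closedBall hδ.le hr.le] at hδU
  have hcont : ContinuousAt (fun x => ⨍ y in Metric.ball x r, u y ∂μ) z :=
    continuousAt_setAverage_ball hr (by linarith) (integrableOn_ball_of_closedBall_subset hu hδU)
  filter_upwards [(continuous_coe_real_ereal.continuousAt.comp hcont).eventually_lt_const hlt,
    Metric.ball_mem_nhds z hδ] with x hx hxz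
  refine (meanEnvelope_le hr ((Metric.closedBall_subset_closedBall' ?_).trans hδU)).trans_lt hx
  linarith [Metric.mem_ball.1 hxz]

theorem meanEnvelope_eq_of_continuousAt (hU : IsOpen U) (hu : LocallyIntegrableOn u U μ)
    (hmono : BallMeansMono μ u U) (hz : z ∈ U) (hc : ContinuousAt u z) :
    meanEnvelope μ u U z = u z := by
  obtain ⟨R, hR, hRU⟩ := Metric.nhds_basis_closedBall.mem_iff.1 (hU.mem_nhds hz)
  have hlim := tendsto_setAverage_ball (μ := μ) hc hR
    (integrableOn_ball_of_closedBall_subset hu hRU)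
  apply le_antisymm
  · refine ge_of_tendsto (continuous_coe_real_ereal.continuousAt.tendsto.comp hlim) ?_
    filter_upwards [Ioo_mem_nhdsGT hR] with r hr
    exact meanEnvelope_le hr.1 ((Metric.closedBall_subset_closedBall hr.2.le).trans hRU)
  · refine le_iInf fun r => EReal.coe_le_coe_iff.2 (le_of_tendsto hlim ?_)
    filter_upwards [Ioo_mem_nhdsGT r.2.1] with t ht
    exact hmono z t r ht.1 ht.2.le r.2.2

end HaarMeanEnvelope

section MonotoneConvergence

variable {α : Type*} [MeasurableSpace α] {μ : Measure α} {f : ℕ → α → ℝ} {W : α → EReal}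

theorem tendsto_lintegral_toENNReal_of_antitone (hf : ∀ k, Integrable (f k) μ)
    (hanti : ∀ᵐ z ∂μ, Antitone fun k => f k z)
    (hlim : ∀ᵐ z ∂μ, Tendsto (fun k => (f k z : EReal)) atTop (𝓝 (W z))) :
    Tendsto (fun k => ∫⁻ z, (f k z : EReal).toENNReal ∂μ) atTop
      (𝓝 (∫⁻ z, (W z).toENNReal ∂μ)) := by
  refine lintegral_tendsto_of_tendsto_of_antitone (fun k =>
    measurable_ereal_toENNReal.comp_aemeasurable (hf k).aemeasurable.coe_real_ereal) ?_ ?_ ?_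
  · filter_upwards [hanti] with z hz i j hij
    exact EReal.toENNReal_le_toENNReal (EReal.coe_le_coe_iff.2 (hz hij))
  · simpa only [EReal.toENNReal_of_ne_top (EReal.coe_ne_top _), EReal.toReal_coe] using
      (hf 0).lintegral_lt_top.ne
  · filter_upwards [hlim] with z hz
    exact (EReal.continuous_toENNReal.tendsto _).comp hz

theorem tendsto_lintegral_toENNReal_neg_of_antitone (hf : ∀ k, AEMeasurable (f k) μ)
    (hanti : ∀ᵐ z ∂μ, Antitone fun k => f k z)
    (hlim : ∀ᵐ z ∂μ, Tendsto (fun k => (f k z : EReal)) atTop (𝓝 (W z))) :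
    Tendsto (fun k => ∫⁻ z, (-(f k z : EReal)).toENNReal ∂μ) atTop
      (𝓝 (∫⁻ z, (-W z).toENNReal ∂μ)) := by
  refine lintegral_tendsto_of_tendsto_of_monotone (fun k =>
    measurable_ereal_toENNReal.comp_aemeasurable (hf k).coe_real_ereal.neg) ?_ ?_
  · filter_upwards [hanti] with z hz i j hij
    exact EReal.toENNReal_le_toENNReal (EReal.neg_le_neg_iff.2 (EReal.coe_le_coe_iff.2 (hz hij)))
  · filter_upwards [hlim] with z hz
    exact (EReal.continuous_toENNReal.tendsto _).comp ((continuous_neg.tendsto _).comp hz)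

end MonotoneConvergence

section DecreasingLimit

variable {n : ℕ} {a : EuclideanSpace ℝ (Fin n)} {r : ℝ} {f : ℕ → EuclideanSpace ℝ (Fin n) → ℝ}
  {W : EuclideanSpace ℝ (Fin n) → EReal}

theorem tendsto_ballMean_of_antitone (hr : 0 < r) (hf : ∀ k, IntegrableOn (f k) (Metric.ball a r))
    (hanti : ∀ z ∈ Metric.ball a r, Antitone fun k => f k z)
    (hlim : ∀ z ∈ Metric.ball a r, Tendsto (fun k => (f k z : EReal)) atTop (𝓝 (W z))) :
    Tendsto (fun k => ballMean (fun z => (f k z : EReal)) a r) atTop (𝓝 (ballMean W a r)) := by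
  have hr0 : volume (Metric.ball a r) ≠ 0 := (Metric.measure_ball_pos volume a hr).ne'
  have hball := ae_restrict_mem (μ := volume) (Metric.isOpen_ball (x := a) (ε := r)).measurableSet
  have hanti' := hball.mono hanti
  have hlim' := hball.mono hlim
  have hpos := tendsto_lintegral_toENNReal_of_antitone hf hanti' hlim'
  have hneg := tendsto_lintegral_toENNReal_neg_of_antitone (fun k => (hf k).aemeasurable)
    hanti' hlim'
  have hfin : ∫⁻ z in Metric.ball a r, (W z).toENNReal ≠ ⊤ := by
    refine ne_top_of_le_ne_top (hf 0).lintegral_lt_top.ne (lintegral_mono_ae ?_)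
    filter_upwards [hanti', hlim'] with z hz hzlim
    rw [← EReal.toReal_coe (f 0 z), ← EReal.toENNReal_of_ne_top (EReal.coe_ne_top _)]
    exact EReal.toENNReal_le_toENNReal (le_of_tendsto' hzlim fun k =>
      EReal.coe_le_coe_iff.2 (hz k.zero_le))
  have hadd := EReal.continuousAt_add
    (p := (_, -((∫⁻ z in Metric.ball a r, (-W z).toENNReal) / volume (Metric.ball a r) : ENNReal)))
    (.inl (EReal.coe_ennreal_eq_top_iff.not.2 (ENNReal.div_ne_top hfin hr0)))
    (.inl (EReal.coe_ennreal_ne_bot _))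
  simp only [ballMean, setLAverage_eq, sub_eq_add_neg]
  exact hadd.tendsto.comp (((continuous_coe_ennreal_ereal.tendsto _).comp
    (ENNReal.Tendsto.div_const hpos (.inr hr0))).prodMk_nhds ((continuous_neg.tendsto _).comp
      ((continuous_coe_ennreal_ereal.tendsto _).comp (ENNReal.Tendsto.div_const hneg (.inr hr0)))))

theorem le_ballMean_of_antitone (hr : 0 < r) (hf : ∀ k, IntegrableOn (f k) (Metric.ball a r))
    (hanti : ∀ z ∈ Metric.ball a r, Antitone fun k => f k z)
    (hW : ∀ z ∈ Metric.ball a r, W z = ⨅ k, (f k z : EReal))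
    (hmean : ∀ k, f k a ≤ ⨍ z in Metric.ball a r, f k z) :
    W a ≤ ballMean W a r := by
  have hlim : ∀ z ∈ Metric.ball a r, Tendsto (fun k => (f k z : EReal)) atTop (𝓝 (W z)) :=
    fun z hz => hW z hz ▸ tendsto_atTop_iInf fun i j hij =>
      EReal.coe_le_coe_iff.2 (hanti z hz hij)
  refine ge_of_tendsto' (tendsto_ballMean_of_antitone hr hf hanti hlim) fun k => ?_
  rw [ballMean_coe hr (hf k), hW a (Metric.mem_ball_self hr)]
  exact (iInf_le _ k).trans (EReal.coe_le_coe_iff.2 (hmean k))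

end DecreasingLimit

section LocallyIntegrable

variable {X Y F : Type*} [TopologicalSpace X] [MeasurableSpace X] [BorelSpace X]
  [TopologicalSpace Y] [MeasurableSpace Y] [BorelSpace Y] [NormedAddCommGroup F]
  {μ : Measure X} {ν : Measure Y}

theorem locallyIntegrableOn_comp_homeomorph {e : X ≃ₜ Y} (he : MeasurePreserving e μ ν)
    {f : Y → F} {U : Set Y} (hf : LocallyIntegrableOn f U ν) :
    LocallyIntegrableOn (f ∘ e) (e ⁻¹' U) μ := by
  intro x hx
  obtain ⟨t, ht, hft⟩ := hf _ hx
  exact ⟨e ⁻¹' t, e.continuous.continuousWithinAt.tendsto_nhdsWithin (mapsTo_preimage _ _) ht,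
    (he.integrableOn_comp_preimage e.measurableEmbedding).2 hft⟩

end LocallyIntegrable

section ProductBalls

variable {X Y : Type*} [PseudoMetricSpace X] [MeasurableSpace X] [PseudoMetricSpace Y]
  [MeasurableSpace Y] {μ : Measure X} {ν : Measure Y} {u : X × Y → ℝ} {U : Set (X × Y)}

/-- The averages of `u` over products of balls inside `U` increase with the radius of the first
factor. Monotonicity in the second radius is the same property of `u ∘ Prod.swap`. -/
def ProdBallMeansMonoLeft (μ : Measure X) (ν : Measure Y) (u : X × Y → ℝ) (U : Set (X × Y)) :
    Prop :=
  ∀ x y r₁ r₂ s, 0 < r₁ → r₁ ≤ r₂ → 0 < s →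
    Metric.closedBall x r₂ ×ˢ Metric.closedBall y s ⊆ U →
    ⨍ z in Metric.ball x r₁ ×ˢ Metric.ball y s, u z ∂(μ.prod ν) ≤
      ⨍ z in Metric.ball x r₂ ×ˢ Metric.ball y s, u z ∂(μ.prod ν)

variable [SFinite μ] [SFinite ν]

theorem ballMeansMono_of_prodBallMeansMonoLeft (hleft : ProdBallMeansMonoLeft μ ν u U)
    (hright : ProdBallMeansMonoLeft ν μ (u ∘ Prod.swap) (Prod.swap ⁻¹' U)) :
    BallMeansMono (μ.prod ν) u U := by
  rintro ⟨x, y⟩ r₁ r₂ hr₁ hr hU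
  rw [← closedBall_prod_same] at hU
  have hU' : Metric.closedBall y r₂ ×ˢ Metric.closedBall x r₂ ⊆ Prod.swap ⁻¹' U := by
    rwa [← image_subset_iff, image_swap_prod]
  rw [← ball_prod_same, ← ball_prod_same]
  calc _ ≤ ⨍ z in Metric.ball x r₂ ×ˢ Metric.ball y r₁, u z ∂(μ.prod ν) :=
        hleft x y r₁ r₂ r₁ hr₁ hr hr₁
          ((prod_mono_right (Metric.closedBall_subset_closedBall hr)).trans hU)
    _ = ⨍ z in Metric.ball y r₁ ×ˢ Metric.ball x r₂, u z.swap ∂(ν.prod μ) :=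
        (setAverage_prod_swap u _ _).symm
    _ ≤ ⨍ z in Metric.ball y r₂ ×ˢ Metric.ball x r₂, u z.swap ∂(ν.prod μ) :=
        hright y x r₁ r₂ r₂ hr₁ hr (hr₁.trans_le hr) hU'
    _ = _ := setAverage_prod_swap u _ _

theorem meanEnvelope_comp_swap (u : X × Y → ℝ) (U : Set (X × Y)) (z : Y × X) :
    meanEnvelope (ν.prod μ) (u ∘ Prod.swap) (Prod.swap ⁻¹' U) z =
      meanEnvelope (μ.prod ν) u U z.swap := by
  obtain ⟨y, x⟩ := z
  have hball : ∀ r, Metric.closedBall (y, x) r ⊆ Prod.swap ⁻¹' U ↔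
      Metric.closedBall (x, y) r ⊆ U := fun r => by
    rw [← closedBall_prod_same, ← closedBall_prod_same, ← image_subset_iff, image_swap_prod]
  have hmean : ∀ r, ⨍ z in Metric.ball (y, x) r, (u ∘ Prod.swap) z ∂(ν.prod μ) =
      ⨍ z in Metric.ball (x, y) r, u z ∂(μ.prod ν) := fun r => by
    rw [← ball_prod_same, ← ball_prod_same]
    exact setAverage_prod_swap u _ _
  simp only [meanEnvelope, iInf_subtype, hball, hmean, Prod.swap_prod_mk]

end ProductBalls

section Slices

theorem exists_closedBall_prod_closedBall_subset {X Y : Type*} [NormedAddCommGroup X]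
    [NormedSpace ℝ X] [ProperSpace X] [PseudoMetricSpace Y] {U : Set (X × Y)} {a : X} {y : Y}
    {s : ℝ} (hU : IsOpen U) (hs : 0 ≤ s)
    (hsU : ∀ x ∈ Metric.closedBall a s, (x, y) ∈ U) :
    ∃ ε > 0, Metric.closedBall a (s + ε) ×ˢ Metric.closedBall y ε ⊆ U := by
  obtain ⟨V, V', hV, hV', hsV, hyV', hVU⟩ := generalized_tube_lemma (isCompact_closedBall a s)
    (isCompact_singleton (x := y)) hU (by rintro ⟨x, y'⟩ ⟨hx, rfl⟩; exact hsU x hx)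
  obtain ⟨ε₁, hε₁, hε₁V⟩ := (isCompact_closedBall a s).exists_cthickening_subset_open hV hsV
  rw [cthickening_closedBall hε₁.le hs, add_comm] at hε₁V
  obtain ⟨ε₂, hε₂, hε₂V'⟩ := Metric.nhds_basis_closedBall.mem_iff.1 (hV'.mem_nhds (hyV' rfl))
  refine ⟨min ε₁ ε₂, lt_min hε₁ hε₂, (Set.prod_mono ?_ ?_).trans hVU⟩
  · exact (Metric.closedBall_subset_closedBall (by gcongr; exact min_le_left _ _)).trans hε₁V
  · exact (Metric.closedBall_subset_closedBall (min_le_right _ _)).trans hε₂V'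

variable {n : ℕ} {G : Type*} [NormedAddCommGroup G] [NormedSpace ℝ G] [FiniteDimensional ℝ G]
  [MeasurableSpace G] [BorelSpace G] {ν : Measure G} [ν.IsAddHaarMeasure]
  {u : EuclideanSpace ℝ (Fin n) × G → ℝ} {U : Set (EuclideanSpace ℝ (Fin n) × G)}
  {a : EuclideanSpace ℝ (Fin n)} {y : G} {s : ℝ}

theorem integrableOn_setAverage_ball_mk {r ε : ℝ} (hr : 0 < r) (hrε : r < ε)
    (hu : ∀ x ∈ Metric.closedBall a s, IntegrableOn u (Metric.ball (x, y) ε)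
      ((volume : Measure (EuclideanSpace ℝ (Fin n))).prod ν)) :
    IntegrableOn (fun x => ⨍ z in Metric.ball (x, y) r, u z ∂(volume.prod ν))
      (Metric.ball a s) := by
  refine IntegrableOn.mono_set (ContinuousOn.integrableOn_compact
    (isCompact_closedBall a s) fun x hx => ?_) Metric.ball_subset_closedBall
  exact (ContinuousAt.comp (f := fun x => (x, y)) (continuousAt_setAverage_ball hr hrε (hu x hx))
    (Continuous.prodMk_left y).continuousAt).continuousWithinAt

theorem meanEnvelope_le_ballMean (hu : LocallyIntegrableOn u U (volume.prod ν))
    (hmono : BallMeansMono (volume.prod ν) u U) (hleft : ProdBallMeansMonoLeft volume ν u U)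
    (hs : 0 < s) {ε : ℝ} (hε : 0 < ε)
    (hεU : Metric.closedBall a (s + ε) ×ˢ Metric.closedBall y ε ⊆ U) :
    meanEnvelope (volume.prod ν) u U (a, y) ≤
      ballMean (fun x => meanEnvelope (volume.prod ν) u U (x, y)) a s := by
  obtain ⟨δ, hδanti, hδ, hδlim⟩ := exists_seq_strictAnti_tendsto' hε
  have hball : ∀ x ∈ Metric.closedBall a s, Metric.closedBall (x, y) ε ⊆ U := fun x hx => by
    rw [← closedBall_prod_same]
    refine (prod_mono_left (Metric.closedBall_subset_closedBall' ?_)).trans hεU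
    linarith [Metric.mem_closedBall.1 hx]
  have hδball : ∀ k, ∀ x ∈ Metric.ball a s, Metric.closedBall (x, y) (δ k) ⊆ U := fun k x hx =>
    (Metric.closedBall_subset_closedBall (hδ k).2.le).trans
      (hball x (Metric.ball_subset_closedBall hx))
  refine le_ballMean_of_antitone (W := fun x => meanEnvelope (volume.prod ν) u U (x, y)) hs
    (f := fun k x => ⨍ z in Metric.ball (x, y) (δ k), u z ∂(volume.prod ν)) (fun k => ?_)
    (fun x hx i j hij => ?_) (fun x hx => ?_) (fun k => ?_)
  · exact integrableOn_setAverage_ball_mk (hδ k).1 (hδ k).2 fun x hx =>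
      integrableOn_ball_of_closedBall_subset hu (hball x hx)
  · exact hmono (x, y) (δ j) (δ i) (hδ j).1 (hδanti.antitone hij) (hδball i x hx)
  · exact meanEnvelope_eq_iInf hmono (fun k => (hδ k).1) hδlim fun k => hδball k x hx
  · simp only [← ball_prod_same]
    have hδU : Metric.closedBall a (s + ε) ×ˢ Metric.closedBall y (δ k) ⊆ U :=
      (prod_mono_right (Metric.closedBall_subset_closedBall (hδ k).2.le)).trans hεU
    refine setAverage_ball_prod_le_setAverage_setAverage (R := s + ε) (hδ k).1 hs
      (by linarith [(hδ k).2]) ?_ fun x r₁ r₂ hr₁ hr hx => ?_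
    · exact ((hu.mono_set hδU).integrableOn_isCompact
        ((isCompact_closedBall _ _).prod (isCompact_closedBall _ _))).mono_set
        (Set.prod_mono Metric.ball_subset_closedBall Metric.ball_subset_closedBall)
    · exact hleft x y r₁ r₂ (δ k) hr₁ hr (hδ k).1
        ((prod_mono_left (hx.trans Metric.ball_subset_closedBall)).trans hδU)

theorem subharmonicOn_meanEnvelope_left (hU : IsOpen U)
    (hu : LocallyIntegrableOn u U (volume.prod ν)) (hmono : BallMeansMono (volume.prod ν) u U)
    (hleft : ProdBallMeansMonoLeft volume ν u U) (y : G) :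
    SubharmonicOn (fun x => meanEnvelope (volume.prod ν) u U (x, y)) {x | (x, y) ∈ U} where
  lt_top _ hx := meanEnvelope_lt_top hU hx
  upperSemicontinuousOn _ _ := UpperSemicontinuousAt.upperSemicontinuousWithinAt _ fun c hc =>
    (Continuous.prodMk_left y).continuousAt.eventually
      (upperSemicontinuousAt_meanEnvelope hU hu c hc)
  le_ballMean a s hs hsU := by
    obtain ⟨ε, hε, hεU⟩ := exists_closedBall_prod_closedBall_subset hU hs.le hsU
    exact meanEnvelope_le_ballMean hu hmono hleft hs hε hεU

theorem subharmonicOn_meanEnvelope_right {u : G × EuclideanSpace ℝ (Fin n) → ℝ}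
    {U : Set (G × EuclideanSpace ℝ (Fin n))} (hU : IsOpen U)
    (hu : LocallyIntegrableOn u U (ν.prod volume)) (hleft : ProdBallMeansMonoLeft ν volume u U)
    (hright : ProdBallMeansMonoLeft volume ν (u ∘ Prod.swap) (Prod.swap ⁻¹' U)) (x : G) :
    SubharmonicOn (fun y => meanEnvelope (ν.prod volume) u U (x, y)) {y | (x, y) ∈ U} := by
  have hswap : LocallyIntegrableOn (u ∘ Prod.swap) (Prod.swap ⁻¹' U) (volume.prod ν) :=
    locallyIntegrableOn_comp_homeomorph (e := .prodComm _ _) Measure.measurePreserving_swap hu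
  simpa only [meanEnvelope_comp_swap, Prod.swap_prod_mk, mem_preimage] using
    subharmonicOn_meanEnvelope_left (hU.preimage continuous_swap) hswap
      (ballMeansMono_of_prodBallMeansMonoLeft hright hleft) hright x

end Slices

section Join

variable {p q : ℕ}

/-- The identification `(x, y) ↦ join x y` of `ℝ^p × ℝ^q`, with the maximum of the two Euclidean
norms so that its balls are products of balls, and `ℝ^(p+q)`. -/
noncomputable def joinEquiv (p q : ℕ) :
    (EuclideanSpace ℝ (Fin p) × EuclideanSpace ℝ (Fin q)) ≃L[ℝ] EuclideanSpace ℝ (Fin (p + q)) :=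
  EuclideanSpace.finAddEquivProd.symm

theorem joinEquiv_apply (z : EuclideanSpace ℝ (Fin p) × EuclideanSpace ℝ (Fin q)) :
    joinEquiv p q z = join z.1 z.2 := by
  ext k
  refine Fin.addCases (fun k => ?_) (fun k => ?_) k <;>
    simp [join, joinEquiv, EuclideanSpace.finAddEquivProd]

theorem join_single_zero (i : Fin p) :
    join (EuclideanSpace.single i 1) (0 : EuclideanSpace ℝ (Fin q)) =
      EuclideanSpace.single (Fin.castAdd q i) 1 := by
  ext k
  refine Fin.addCases (fun k => ?_) (fun k => ?_) k
  · simp [join]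
  · simp [join, Fin.ext_iff, (i.isLt.trans_le (Nat.le_add_right _ _)).ne']

theorem join_zero_single (i : Fin q) :
    join (0 : EuclideanSpace ℝ (Fin p)) (EuclideanSpace.single i 1) =
      EuclideanSpace.single (Fin.natAdd p i) 1 := by
  ext k
  refine Fin.addCases (fun k => ?_) (fun k => ?_) k
  · simp [join, Fin.ext_iff, (k.isLt.trans_le (Nat.le_add_right _ _)).ne]
  · simp [join]

theorem measurePreserving_joinEquiv :
    MeasurePreserving (joinEquiv p q) (volume.prod volume) volume := by
  have hsum := (PiLp.sumPiLpEquivProdLpPiLp 2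
    (fun _ : Fin p ⊕ Fin q => ℝ)).symm.measurePreserving
  have hreindex := (LinearIsometryEquiv.piLpCongrLeft 2 ℝ ℝ
    (finSumFinEquiv (m := p) (n := q)).symm).symm.measurePreserving
  exact hreindex.comp (hsum.comp (WithLp.volume_preserving_toLp _ _))

end Join

section SliceMonotonicity

variable {n N : ℕ} {G : Type*} [NormedAddCommGroup G] [NormedSpace ℝ G]
  {e : (EuclideanSpace ℝ (Fin n) × G) ≃L[ℝ] EuclideanSpace ℝ (Fin N)} {σ : Fin n → Fin N}
  {Ω E : Set (EuclideanSpace ℝ (Fin N))} {w : EuclideanSpace ℝ (Fin N) → ℝ}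

theorem partialDeriv_comp_prodMk (hσ : ∀ i, e (EuclideanSpace.single i 1, 0) =
    EuclideanSpace.single (σ i) 1) (i : Fin n) (y : G) :
    partialDeriv i (fun x => w (e (x, y))) = fun x => partialDeriv (σ i) w (e (x, y)) := by
  ext x
  have hline : ∀ t : ℝ, e (x + t • EuclideanSpace.single i 1, y) =
      e (x, y) + t • EuclideanSpace.single (σ i) 1 := fun t => by
    rw [← hσ, ← map_smul, ← map_add]
    simp
  simp only [partialDeriv, lineDeriv, hline]

theorem sum_partialDeriv_nonneg_of_subharmonicOn_slice
    (hσ : ∀ i, e (EuclideanSpace.single i 1, 0) = EuclideanSpace.single (σ i) 1)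
    {U : Set (EuclideanSpace ℝ (Fin N))} (hU : IsOpen U) (hw : ContDiffOn ℝ 2 w U)
    (hsub : ∀ y, SubharmonicOn (fun x => (w (e (x, y)) : EReal)) {x | e (x, y) ∈ U})
    {z : EuclideanSpace ℝ (Fin N)} (hz : z ∈ U) :
    0 ≤ ∑ i, partialDeriv (σ i) (partialDeriv (σ i) w) z := by
  obtain ⟨⟨x, y⟩, rfl⟩ := e.surjective z
  have hslice : ContDiff ℝ 2 fun x => e (x, y) := e.contDiff.comp (contDiff_prodMk_left y)
  have hΔ := (hsub y).laplacian_nonneg (hU.preimage hslice.continuous)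
    (hw.comp hslice.contDiffOn fun _ hx => hx) hz
  simpa only [Function.comp_def, partialDeriv_comp_prodMk hσ] using hΔ

variable [FiniteDimensional ℝ G] [MeasurableSpace G] [BorelSpace G] {ν : Measure G} [SFinite ν]

theorem prodBallMeansMonoLeft_of_subharmonicOn_slices
    (he : MeasurePreserving e (volume.prod ν) volume)
    (hσ : ∀ i, e (EuclideanSpace.single i 1, 0) = EuclideanSpace.single (σ i) 1)
    (hΩE : IsOpen (Ω \ E)) (hE : Measure.hausdorffMeasure ((N : ℝ) - 1) E = 0)
    (hw_loc : LocallyIntegrableOn w Ω) (hw : ContDiffOn ℝ 2 w (Ω \ E))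
    (hw₂ : ∀ i, LocallyIntegrableOn (partialDeriv (σ i) (partialDeriv (σ i) w)) Ω)
    (hsub : ∀ y, SubharmonicOn (fun x => (w (e (x, y)) : EReal)) {x | e (x, y) ∈ Ω \ E}) :
    ProdBallMeansMonoLeft volume ν (w ∘ e) (e ⁻¹' Ω) := by
  intro x y r₁ r₂ s hr₁ hr _ hΩ
  let π : EuclideanSpace ℝ (Fin N) →L[ℝ] EuclideanSpace ℝ (Fin n) := .fst ℝ _ G ∘L e.symm
  let L : Set (EuclideanSpace ℝ (Fin N)) := (fun z => (e.symm z).2) ⁻¹' Metric.ball y s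
  have hL : MeasurableSet L :=
    (Metric.isOpen_ball.preimage (continuous_snd.comp e.symm.continuous)).measurableSet
  have hprod : ∀ r, e ⁻¹' (L ∩ π ⁻¹' Metric.ball x r) = Metric.ball x r ×ˢ Metric.ball y s :=
    fun r => by ext z; simp [L, π, and_comm]
  have hK := ((isCompact_closedBall x r₂).prod (isCompact_closedBall y s)).image e.continuous
  have hKΩ := image_subset_iff.2 hΩ
  have hsymm : ∀ i, e.symm (EuclideanSpace.single (σ i) 1) = (EuclideanSpace.single i 1, 0) :=
    fun i => e.symm_apply_eq.2 (hσ i).symm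
  have hmono := inv_pow_mul_setIntegral_mono (π := π) (a := x) (L := L) (μ := volume)
    (v := fun i => EuclideanSpace.single (σ i) 1) (EuclideanSpace.basisFun (Fin n) ℝ)
    (by simp [π, hsymm]) (by rwa [finrank_euclideanSpace_fin]) hL (by simp [L, hsymm]) hK hr₁ hr
    ?_ (fun i z hz => hasLineDerivAt_partialDeriv hΩE (hw.of_le one_le_two) (σ i) ⟨hKΩ hz.1, hz.2⟩)
    (fun i z hz => hasLineDerivAt_partialDeriv hΩE (contDiffOn_partialDeriv hΩE hw (σ i)) (σ i)
      ⟨hKΩ hz.1, hz.2⟩)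
    ((hw_loc.mono_set hKΩ).integrableOn_isCompact hK)
    (fun i => ((hw₂ i).mono_set hKΩ).integrableOn_isCompact hK)
    (fun z hz => sum_partialDeriv_nonneg_of_subharmonicOn_slice hσ hΩE hw hsub ⟨hKΩ hz.1, hz.2⟩)
  · simp only [← he.setIntegral_preimage_emb e.toHomeomorph.measurableEmbedding, hprod,
      Fintype.card_fin] at hmono
    rw [setAverage_ball_prod_eq_inv_pow_mul _ _ _ hr₁,
      setAverage_ball_prod_eq_inv_pow_mul _ _ _ (hr₁.trans_le hr), finrank_euclideanSpace_fin]
    exact mul_le_mul_of_nonneg_left hmono (by positivity)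
  · rw [← image_preimage_eq (L ∩ _) e.surjective, hprod]
    exact image_mono (Set.prod_mono Metric.ball_subset_closedBall Metric.ball_subset_closedBall)

end SliceMonotonicity

section Join

variable {p q : ℕ} {Ω E : Set (EuclideanSpace ℝ (Fin (p + q)))}
  {w : EuclideanSpace ℝ (Fin (p + q)) → ℝ}

theorem prodBallMeansMonoLeft_of_separatelySubharmonicOn (hΩE : IsOpen (Ω \ E))
    (hE : Measure.hausdorffMeasure ((p : ℝ) + (q : ℝ) - 1) E = 0)
    (hw_sub : SeparatelySubharmonicOn p q (fun z => (w z : EReal)) (Ω \ E))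
    (hw_loc : LocallyIntegrableOn w Ω) (hw : ContDiffOn ℝ 2 w (Ω \ E))
    (hw₂ : ∀ i, LocallyIntegrableOn (partialDeriv i (partialDeriv i w)) Ω) :
    ProdBallMeansMonoLeft volume volume (w ∘ joinEquiv p q) (joinEquiv p q ⁻¹' Ω) ∧
      ProdBallMeansMonoLeft volume volume ((w ∘ joinEquiv p q) ∘ Prod.swap)
        (Prod.swap ⁻¹' (joinEquiv p q ⁻¹' Ω)) := by
  let j' := (ContinuousLinearEquiv.prodComm ℝ _ _).trans (joinEquiv p q)
  have hj' : ∀ z, j' z = join z.2 z.1 := fun z => joinEquiv_apply z.swap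
  have hj'_vol : MeasurePreserving j' (volume.prod volume) :=
    measurePreserving_joinEquiv.comp Measure.measurePreserving_swap
  rw [← Nat.cast_add] at hE
  exact ⟨prodBallMeansMonoLeft_of_subharmonicOn_slices measurePreserving_joinEquiv
      (fun i => (joinEquiv_apply _).trans (join_single_zero i)) hΩE hE hw_loc hw (fun _ => hw₂ _)
      (by simpa only [joinEquiv_apply] using hw_sub.1),
    prodBallMeansMonoLeft_of_subharmonicOn_slices (Ω := Ω) hj'_vol
      (fun i => (hj' _).trans (join_zero_single i)) hΩE hE hw_loc hw (fun _ => hw₂ _)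
      (by simpa only [hj'] using hw_sub.2)⟩

end Join

end SepSubharmonic

open SepSubharmonic in
theorem corollary4_general (p q : ℕ) (Ω E : Set (EuclideanSpace ℝ (Fin (p + q))))
    (hΩ_open : IsOpen Ω) (hE_closed : IsClosed ((↑) ⁻¹' E : Set Ω))
    (hE_null : Measure.hausdorffMeasure ((p : ℝ) + (q : ℝ) - 1) E = 0)
    (w : EuclideanSpace ℝ (Fin (p + q)) → ℝ)
    (hw_sub : SeparatelySubharmonicOn p q (fun z => (w z : EReal)) (Ω \ E))
    (hw_loc : LocallyIntegrableOn w Ω volume) (hw_C2 : ContDiffOn ℝ 2 w (Ω \ E))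
    (hw_dd : ∀ i, LocallyIntegrableOn (partialDeriv i (partialDeriv i w)) Ω volume) :
    ∃ W : EuclideanSpace ℝ (Fin (p + q)) → EReal,
      (∀ z ∈ Ω \ E, W z = (w z : EReal)) ∧ SeparatelySubharmonicOn p q W Ω := by
  have hΩE : IsOpen (Ω \ E) := by
    have := hΩ_open.isOpenMap_subtype_val _ hE_closed.isOpen_compl
    rwa [← preimage_compl, Subtype.image_preimage_coe, ← sdiff_eq] at this
  let j := joinEquiv p q
  have hj : ∀ x y, join x y = j (x, y) := fun x y => (joinEquiv_apply (x, y)).symm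
  have hU : IsOpen (j ⁻¹' Ω) := hΩ_open.preimage j.continuous
  have hloc : LocallyIntegrableOn (w ∘ j) (j ⁻¹' Ω) (volume.prod volume) :=
    locallyIntegrableOn_comp_homeomorph (e := j.toHomeomorph) measurePreserving_joinEquiv hw_loc
  obtain ⟨hleft, hright⟩ :=
    prodBallMeansMonoLeft_of_separatelySubharmonicOn hΩE hE_null hw_sub hw_loc hw_C2 hw_dd
  have hmono := ballMeansMono_of_prodBallMeansMonoLeft hleft hright
  have hcont : ContinuousOn (w ∘ j) (j ⁻¹' (Ω \ E)) :=
    hw_C2.continuousOn.comp j.continuous.continuousOn (mapsTo_preimage _ _)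
  refine ⟨fun z => meanEnvelope (volume.prod volume) (w ∘ j) (j ⁻¹' Ω) (j.symm z),
    j.surjective.forall.2 fun z hz => ?_, fun y => ?_, fun x => ?_⟩
  · simpa only [j.symm_apply_apply, Function.comp_apply] using
      meanEnvelope_eq_of_continuousAt hU hloc hmono hz.1
        (hcont.continuousAt ((hΩE.preimage j.continuous).mem_nhds hz))
  · simpa only [hj, j.symm_apply_apply, mem_preimage] using
      subharmonicOn_meanEnvelope_left hU hloc hmono hleft y
  · simpa only [hj, j.symm_apply_apply, mem_preimage] using
      subharmonicOn_meanEnvelope_right hU hloc hleft hright x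

/-- A function `w : Ω \ E → ℝ` is represented by a function on the whole space whose values
outside `Ω \ E` are arbitrary: `Ω \ E` is open, so derivatives there do not see these values, and
`E` is a Lebesgue null set, so neither does local integrability on `Ω`. -/
theorem corollary4 (p q : ℕ) (hp : 2 ≤ p) (hq : 2 ≤ q)
    (Ω E : Set (EuclideanSpace ℝ (Fin (p + q))))
    (hΩ_open : IsOpen Ω) (hΩ_conn : IsConnected Ω)
    (hE_sub : E ⊆ Ω) (hE_closed : IsClosed ((↑) ⁻¹' E : Set Ω))
    (hE_null : Measure.hausdorffMeasure ((p : ℝ) + (q : ℝ) - 1) E = 0)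
    (w : EuclideanSpace ℝ (Fin (p + q)) → ℝ)
    (hw_sub : SepSubharmonic.SeparatelySubharmonicOn p q (fun z => (w z : EReal)) (Ω \ E))
    (hw_loc : LocallyIntegrableOn w Ω volume)
    (hw_C2 : ContDiffOn ℝ 2 w (Ω \ E))
    (hw_dd : ∀ i : Fin (p + q), LocallyIntegrableOn
      (SepSubharmonic.partialDeriv i (SepSubharmonic.partialDeriv i w)) Ω volume) :
    ∃ W : EuclideanSpace ℝ (Fin (p + q)) → EReal,
      (∀ z ∈ Ω \ E, W z = (w z : EReal)) ∧
      SepSubharmonic.SeparatelySubharmonicOn p q W Ω :=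
  corollary4_general p q Ω E hΩ_open hE_closed hE_null w hw_sub hw_loc hw_C2 hw_dd
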